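/- Let $k\ge 0$ be an integer, $p$ an odd prime and $2\le j\le p-1$. Let $\mathcal M_p$ be the moduli space of pairs $(f,c)$, where $f\in\mathbb C[z]$ has degree $p$ and $c\in\mathbb C$ is a marked critical point, $f'(c)=0$, modulo affine conjugation: $(f,c)\sim(h\circ f\circ h^{-1},h(c))$ for $h(z)=az+b$, $a\ne0$. Every class is represented by a monic polynomial $f$ with vanishing coefficient of $z^{p-1}$; with $\alpha_1,\dots,\alpha_{p-1}$ the critical points of $f$ (with multiplicity; $\sum_i\alpha_i=0$), $\alpha_1=c$ the marked one, and $\beta=f(\alpha_1)$, $$f(z)=z^{p}+\sum_{i=2}^{p-1}(-1)^i\tfrac{p}{p-i}s_i(\alpha)z^{p-i}-\alpha_1^{p}-\sum_{i=2}^{p-1}(-1)^i\tfrac{p}{p-i}s_i(\alpha)\alpha_1^{p-i}+\beta ,$$ where $s_i$ is the $i$-th elementary symmetric polynomial. This gives a surjection $\mathbb C^{p-1}\cong\{(\alpha,\beta)\in\mathbb C^{p}:\sum_i\alpha_i=0\}\to\mathcal M_p$, which is the quotient by the finite group generated by the permutations of $\alpha_2,\dots,\alpha_{p-1}$ and multiplication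 of all coordinates by $(p-1)$-th roots of unity; $\mathcal M_p$ is thereby an affine variety, whose regular functions are the functions that pull back to polynomials on $\mathbb C^{p-1}$. Call $c$ strictly $(k,1)$-preperiodic under $f$ if $f^{k+1}(c)=f^{k}(c)$ and $f^{l+1}(c)\ne f^{l}(c)$ for all $0\le l<k$ (iterates of $f$). The ramification index of $(f,c)$ is the multiplicity of $c$ as a root of $f(z)-f(c)$. Both notions are invariant under affine conjugation. Then the set of points of $\mathcal M_p$ for which the marked critical point is strictly $(k,1)$-preperiodic and has ramification index exactly $j$ is an irreducible (in particular non-empty) quasi-affine variety, i.e. an irreducible locally closed subset of $\mathcal M_p$ in the Zariski topology, and its dimension is $p-j$. -/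

import Mathlib

open Polynomial

namespace MarkedModuli

/-- `x` is strictly `(k, n)`-preperiodic under `g` (for `n ≥ 1`): `g^{k+n}(x) = g^k(x)`, and no pair
`(l, m) ≠ (k, n)` with `0 ≤ l ≤ k`, `1 ≤ m ≤ n` satisfies `g^{l+m}(x) = g^l(x)`. -/
def IsStrictlyPreperiodic (g : ℂ → ℂ) (k n : ℕ) (x : ℂ) : Prop :=
  g^[k + n] x = g^[k] x ∧
    ∀ l m : ℕ, l ≤ k → 1 ≤ m → m ≤ n → (l, m) ≠ (k, n) → g^[l + m] x ≠ g^[l] x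

/-- A complex polynomial of degree `d` together with a marked critical point. -/
structure MarkedPoly (d : ℕ) where
  poly : ℂ[X]
  point : ℂ
  natDegree_eq : poly.natDegree = d
  isCritical : poly.derivative.eval point = 0

/-- The ramification index of the marked critical point `c` of `f`: the multiplicity of `c` as a
root of `f(z) - f(c)`. -/
noncomputable def MarkedPoly.ramificationIndex {d : ℕ} (F : MarkedPoly d) : ℕ :=
  (F.poly - C (F.poly.eval F.point)).rootMultiplicity F.point

/-- Affine conjugation of marked polynomials: for some `h(z) = a z + b` with `a ≠ 0` one has
`G = h ∘ F ∘ h⁻¹` (written `G ∘ h = h ∘ F`), and `h` carries the marked point of `F` to that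
of `G`. -/
def AffineConj {d : ℕ} (F G : MarkedPoly d) : Prop :=
  ∃ a b : ℂ, a ≠ 0 ∧ (∀ z : ℂ, G.poly.eval (a * z + b) = a * F.poly.eval z + b) ∧
    G.point = a * F.point + b

theorem affineConj_equivalence (d : ℕ) : Equivalence (AffineConj (d := d)) where
  refl F := ⟨1, 0, one_ne_zero, by simp, by simp⟩
  symm := by
    rintro F G ⟨a, b, ha, h, hp⟩
    refine ⟨a⁻¹, -(a⁻¹ * b), inv_ne_zero ha, fun z => ?_, ?_⟩
    · have := h (a⁻¹ * z + -(a⁻¹ * b))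
      have e : a * (a⁻¹ * z + -(a⁻¹ * b)) + b = z := by field_simp; ring
      rw [e] at this
      rw [this]; field_simp; ring
    · rw [hp]; field_simp; ring
  trans := by
    rintro F G H ⟨a, b, ha, h, hp⟩ ⟨a', b', ha', h', hp'⟩
    refine ⟨a' * a, a' * b + b', mul_ne_zero ha' ha, fun z => ?_, ?_⟩
    · have := h' (a * z + b)
      rw [h z] at this
      rw [show a' * a * z + (a' * b + b') = a' * (a * z + b) + b' by ring, this]; ring
    · rw [hp', hp]; ring

instance markedPolySetoid (d : ℕ) : Setoid (MarkedPoly d) := ⟨AffineConj, affineConj_equivalence d⟩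

/-- The moduli space `𝓜_d` of degree `d` polynomials with a marked critical point, modulo affine
conjugation. -/
def Moduli (d : ℕ) : Type := Quotient (markedPolySetoid d)

/-- Points of the affine space `ℂ^{d-1}` parametrizing monic reduced polynomials with a marked
critical point `α₁`: the coordinates `some i` are the other finite critical points
`α₂, …, α_{d-1}`, the coordinate `none` is the critical value `β = f(α₁)`. -/
abbrev Param (d : ℕ) : Type := Option (Fin (d - 2)) → ℂ

/-- The marked critical point `α₁ = -(α₂ + ⋯ + α_{d-1})`. -/
noncomputable def Param.marked {d : ℕ} (x : Param d) : ℂ := -∑ i, x (some i)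

/-- The multiset `α₁, α₂, …, α_{d-1}` of finite critical points; their sum is zero. -/
noncomputable def Param.critPts {d : ℕ} (x : Param d) : Multiset ℂ :=
  x.marked ::ₘ (Finset.univ : Finset (Fin (d - 2))).val.map (fun i => x (some i))

/-- `z^d + ∑_{i=2}^{d-1} (-1)^i (d / (d - i)) s_i(α) z^{d-i}`, with `s_i` the elementary symmetric
polynomials. -/
noncomputable def Param.normalFormAux {d : ℕ} (x : Param d) : ℂ[X] :=
  X ^ d + ∑ i ∈ Finset.Icc 2 (d - 1),
    C ((-1) ^ i * ((d : ℂ) / ((d : ℂ) - (i : ℂ))) * x.critPts.esymm i) * X ^ (d - i)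

/-- The normal form: the monic reduced polynomial `f` of degree `d` with finite critical points
`α₁, …, α_{d-1}` and with `f(α₁) = β`. -/
noncomputable def Param.normalForm {d : ℕ} (x : Param d) : ℂ[X] :=
  x.normalFormAux - C (x.normalFormAux.eval x.marked) + C (x none)

theorem Param.natDegree_normalForm {d : ℕ} (hd : 2 ≤ d) (x : Param d) :
    x.normalForm.natDegree = d := by
  have h : x.normalForm = X ^ d + ((∑ i ∈ Finset.Icc 2 (d - 1),
      C ((-1) ^ i * ((d : ℂ) / ((d : ℂ) - (i : ℂ))) * x.critPts.esymm i) * X ^ (d - i))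
      - C (x.normalFormAux.eval x.marked) + C (x none)) := by
    unfold Param.normalForm
    rw [Param.normalFormAux]
    ring
  rw [h]
  refine natDegree_eq_of_degree_eq_some ?_
  rw [degree_add_eq_left_of_degree_lt, degree_X_pow]
  rw [degree_X_pow]
  have hc : ∀ c : ℂ, (C c).degree < (d : WithBot ℕ) := fun c =>
    lt_of_le_of_lt degree_C_le (by exact_mod_cast (by omega : 0 < d))
  refine lt_of_le_of_lt (degree_add_le _ _) (max_lt (lt_of_le_of_lt (degree_sub_le _ _)
    (max_lt ?_ (hc _))) (hc _))
  refine lt_of_le_of_lt (degree_sum_le _ _) ?_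
  refine (Finset.sup_lt_iff (WithBot.bot_lt_coe d)).2 fun i hi => ?_
  rw [Finset.mem_Icc] at hi
  exact lt_of_le_of_lt (degree_C_mul_X_pow_le _ _) (WithBot.coe_lt_coe.2 (by omega : d - i < d))

theorem Param.derivative_normalForm {d : ℕ} (hd : 2 ≤ d) (x : Param d) :
    x.normalForm.derivative = C (d : ℂ) * (x.critPts.map (fun t => X - C t)).prod := by
  have hcard : x.critPts.card = d - 1 := by
    simp [Param.critPts]; omega
  have h0 : x.critPts.esymm 0 = 1 := by
    simp [Multiset.esymm]
  have h1 : x.critPts.esymm 1 = 0 := by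
    have hs : ∀ s : Multiset ℂ, s.esymm 1 = s.sum := fun s => by
      simp [Multiset.esymm, Multiset.powersetCard_one, Multiset.map_map]
    rw [hs, Param.critPts, Multiset.sum_cons, Param.marked]
    exact neg_add_cancel _
  rw [Multiset.prod_X_sub_X_eq_sum_esymm, hcard, Finset.mul_sum]
  obtain ⟨n, rfl⟩ : ∃ n, d = n + 2 := ⟨d - 2, by omega⟩
  have e : Finset.Icc 2 (n + 2 - 1) = (Finset.range n).map (addRightEmbedding 2) := by
    ext i
    simp only [Finset.mem_Icc, Finset.mem_map, Finset.mem_range, addRightEmbedding_apply]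
    constructor
    · intro h; exact ⟨i - 2, by omega, by omega⟩
    · rintro ⟨a, h, rfl⟩; omega
  have hl : x.normalForm.derivative = C ((n + 2 : ℕ) : ℂ) * X ^ (n + 1) +
      ∑ i ∈ Finset.range n, C (((-1) ^ (i + 2) * (((n + 2 : ℕ) : ℂ) / (((n + 2 : ℕ) : ℂ)
        - ((i + 2 : ℕ) : ℂ))) * x.critPts.esymm (i + 2)) * ((n + 2 - (i + 2) : ℕ) : ℂ))
        * X ^ (n + 2 - (i + 2) - 1) := by
    rw [Param.normalForm, Param.normalFormAux, e, Finset.sum_map]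
    simp only [addRightEmbedding_apply, derivative_add, derivative_sub, derivative_C,
      derivative_sum, derivative_X_pow, derivative_C_mul_X_pow, sub_zero, add_zero]
    rfl
  rw [hl, show n + 2 - 1 + 1 = n + 1 + 1 by omega, Finset.sum_range_succ', Finset.sum_range_succ',
    h0, zero_add, h1, C_0, zero_mul, mul_zero, mul_zero, add_zero, add_comm]
  refine congrArg₂ (· + ·) (Finset.sum_congr rfl fun i hi => ?_) ?_
  · rw [Finset.mem_range] at hi
    have hne : ((n + 2 : ℕ) : ℂ) - ((i + 2 : ℕ) : ℂ) ≠ 0 := by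
      rw [sub_ne_zero]; exact_mod_cast (by omega : n + 2 ≠ i + 2)
    have hs : ((n + 2 - (i + 2) : ℕ) : ℂ) = ((n + 2 : ℕ) : ℂ) - ((i + 2 : ℕ) : ℂ) :=
      Nat.cast_sub (by omega)
    have hc : ((-1) ^ (i + 2) * (((n + 2 : ℕ) : ℂ) / (((n + 2 : ℕ) : ℂ) - ((i + 2 : ℕ) : ℂ)))
        * x.critPts.esymm (i + 2)) * ((n + 2 - (i + 2) : ℕ) : ℂ)
        = ((n + 2 : ℕ) : ℂ) * ((-1) ^ (i + 2) * x.critPts.esymm (i + 2)) := by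
      rw [hs]; field_simp
    rw [hc, show n + 2 - 1 - (i + 1 + 1) = n + 2 - (i + 2) - 1 by omega, C_mul, C_mul, C_pow,
      C_neg, C_1]
    ring
  · rw [pow_zero, one_mul, C_1, one_mul]
    rfl

/-- The parametrization of marked polynomials by the normal form, marked at `α₁`. -/
noncomputable def Param.toMarkedPoly {d : ℕ} [d.AtLeastTwo] (x : Param d) : MarkedPoly d where
  poly := x.normalForm
  point := x.marked
  natDegree_eq := x.natDegree_normalForm Nat.AtLeastTwo.prop
  isCritical := by
    rw [x.derivative_normalForm Nat.AtLeastTwo.prop]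
    simp [Param.critPts]

/-- The parametrization `ℂ^{d-1} → 𝓜_d`. It is the quotient by the finite group generated by the
permutations of `α₂, …, α_{d-1}` and by multiplication of all coordinates with `(d-1)`-th roots of
unity. -/
noncomputable def Param.toModuli {d : ℕ} [d.AtLeastTwo] (x : Param d) : Moduli d :=
  Quotient.mk (markedPolySetoid d) x.toMarkedPoly

/-- The coordinate ring of the affine variety `𝓜_d`: the functions on `𝓜_d` whose pullback to
`ℂ^{d-1}` is a polynomial function. (So it is the ring of polynomials on `ℂ^{d-1}` invariant under
the finite group above.) -/
noncomputable def regularFunctions (d : ℕ) [d.AtLeastTwo] : Subalgebra ℂ (Moduli d → ℂ) where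
  carrier := {φ | ∃ P : MvPolynomial (Option (Fin (d - 2))) ℂ,
    ∀ x : Param d, φ x.toModuli = MvPolynomial.eval x P}
  mul_mem' := by
    rintro φ ψ ⟨P, hP⟩ ⟨Q, hQ⟩
    exact ⟨P * Q, fun x => by simp [hP, hQ]⟩
  add_mem' := by
    rintro φ ψ ⟨P, hP⟩ ⟨Q, hQ⟩
    exact ⟨P + Q, fun x => by simp [hP, hQ]⟩
  algebraMap_mem' c := ⟨MvPolynomial.C c, fun x => by simp⟩

/-- The zero locus in `𝓜_d` of a set of functions. -/
def zeroLocus {d : ℕ} (I : Set (Moduli d → ℂ)) : Set (Moduli d) := {m | ∀ φ ∈ I, φ m = 0}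

/-- The Zariski topology on `𝓜_d`: the closed sets are the zero loci of sets of regular
functions. -/
noncomputable instance zariskiTopology (d : ℕ) [d.AtLeastTwo] : TopologicalSpace (Moduli d) :=
  TopologicalSpace.ofClosed
    {Z | ∃ I : Set (Moduli d → ℂ), I ⊆ regularFunctions d ∧ Z = zeroLocus I}
    ⟨{1}, by simp, by ext m; simp [zeroLocus]⟩
    (by
      intro A hA
      refine ⟨{φ | φ ∈ regularFunctions d ∧ ∃ Z ∈ A, ∃ I : Set (Moduli d → ℂ),
        I ⊆ regularFunctions d ∧ Z = zeroLocus I ∧ φ ∈ I}, fun φ hφ => hφ.1, ?_⟩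
      ext m
      constructor
      · rintro h φ ⟨-, Z, hZA, I, -, rfl, hφ⟩
        exact h _ hZA φ hφ
      · intro h Z hZA
        obtain ⟨I, hI, rfl⟩ := hA hZA
        exact fun φ hφ => h φ ⟨hI hφ, _, hZA, I, hI, rfl, hφ⟩)
    (by
      rintro _ ⟨I, hI, rfl⟩ _ ⟨J, hJ, rfl⟩
      refine ⟨{χ | ∃ φ ∈ I, ∃ ψ ∈ J, χ = φ * ψ}, ?_, ?_⟩
      · rintro _ ⟨φ, hφ, ψ, hψ, rfl⟩
        exact mul_mem (hI hφ) (hJ hψ)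
      · ext m
        simp only [zeroLocus, Set.mem_union, Set.mem_ofPred_eq]
        constructor
        · rintro (h | h) _ ⟨φ, hφ, ψ, hψ, rfl⟩
          · simp [h φ hφ]
          · simp [h ψ hψ]
        · intro h
          by_contra! hc
          obtain ⟨⟨φ, hφ, h1⟩, ψ, hψ, h2⟩ := hc
          have := h _ ⟨φ, hφ, ψ, hψ, rfl⟩
          simp [h1, h2] at this)

/-- The set of points of `𝓜_d` for which the marked critical point is strictly
`(k, n)`-preperiodic and has ramification index exactly `j`. -/
def preperiodicLocus (d k n j : ℕ) : Set (Moduli d) :=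
  {m | ∃ F : MarkedPoly d, Quotient.mk (markedPolySetoid d) F = m ∧
    IsStrictlyPreperiodic (fun z => F.poly.eval z) k n F.point ∧ F.ramificationIndex = j}

instance atLeastTwo_of_prime (p : ℕ) [hp : Fact p.Prime] : p.AtLeastTwo := ⟨hp.out.two_le⟩

end MarkedModuli

/-! Moving the marked point to `0` and making the polynomial monic turns ramification index `j < p`
into the shape `z^p + a_0 z^j + ... + a_{p-j-1} z^{p-1} + b` with `a_0 ≠ 0`. The pair `(a, b)` is
unique up to `(p-1)`-th roots of unity. Write `x_l` for the orbit of `0`. Dividing `f(x) - f(y)` by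
`x - y` gives `x_{k+2} - x_{k+1} = (x_{k+1} - x_k) b^{j-1} H_k`, where `H_k` is `misiurewicz`. When
`a_0 ≠ 0`, strict `(k+1, 1)`-preperiodicity therefore means `H_k = 0` and `x_{k+1} ≠ x_k`; for `k =
0` the equation is just `b = 0`.

The heart is that `H_k` is irreducible in `ℂ[a][b]`. It is monic in `b`. Modulo a prime above `p`,
at `a = 0`, Frobenius gives `x_{l+1} - x_l = b^{p^l}`, so `H_k` reduces to a power of `b`. Its value
at `b = 0` is `a_0` or `j a_0`, of order exactly one because `p ∤ j`. Eisenstein's criterion gives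
irreducibility over the algebraic integers (`misiurewicz_irreducible_of_mem`), and integral
closedness carries it to `ℂ`. So the locus is the image of a nonempty open part of an irreducible
hypersurface, and irreducibility follows from the Nullstellensatz.

For the dimension, the functions `a_i^{p-1}` are regular, and all regular functions on the locus are
integral over the polynomial ring in them, since `b` is a root of a monic equation over `ℂ[a]`. This
bounds the dimension by `p - j`. Irreducibility holds equally when only the first `m ≥ 1`
coefficients `a_i` are allowed to be nonzero; these nested subfamilies, preceded by a point, form a
chain of length `p - j`. -/

namespace MarkedModuli

/-! ### Consecutive differences of the critical orbit. -/

/-- The orbit of `0` under `z ↦ z ^ p + ∑ i, a i * z ^ (j + i) + b`. -/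
def criticalOrbit {R : Type*} [CommRing R] (p j : ℕ) {m : ℕ} (a : Fin m → R) (b : R) : ℕ → R
  | 0 => 0
  | l + 1 => criticalOrbit p j a b l ^ p + ∑ i, a i * criticalOrbit p j a b l ^ (j + (i : ℕ)) + b

/-- The orbit of `0` divided by `b`. -/
def reducedOrbit {R : Type*} [CommRing R] (p j : ℕ) {m : ℕ} (a : Fin m → R) (b : R) : ℕ → R
  | 0 => 0
  | l + 1 => b ^ (p - 1) * reducedOrbit p j a b l ^ p +
      ∑ i, a i * b ^ (j + (i : ℕ) - 1) * reducedOrbit p j a b l ^ (j + (i : ℕ)) + 1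

/-- The quotient `(x ^ e - y ^ e) / (x - y)`. -/
def geomQuot {R : Type*} [CommRing R] (e : ℕ) (x y : R) : R :=
  ∑ r ∈ Finset.range e, x ^ r * y ^ (e - 1 - r)

/-- The cofactor of `(x_{k+1} - x_k) * b ^ (j - 1)` in `x_{k+2} - x_{k+1}`, for `x_l` the orbit of
`0`. -/
def misiurewicz {R : Type*} [CommRing R] (p j : ℕ) {m : ℕ} (a : Fin m → R) (b : R) (k : ℕ) : R :=
  b ^ (p - j) * geomQuot p (reducedOrbit p j a b (k + 1)) (reducedOrbit p j a b k) +
    ∑ i, a i * b ^ (i : ℕ) *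
      geomQuot (j + (i : ℕ)) (reducedOrbit p j a b (k + 1)) (reducedOrbit p j a b k)

section Ring

variable {R S : Type*} [CommRing R] [CommRing S] (p j : ℕ) {m : ℕ} (a : Fin m → R) (b : R)

theorem geomQuot_mul (e : ℕ) (x y : R) : geomQuot e x y * (x - y) = x ^ e - y ^ e :=
  (Commute.all x y).geom_sum₂_mul e

theorem geomQuot_mul_left (e : ℕ) (x y : R) :
    geomQuot e (b * x) (b * y) = b ^ (e - 1) * geomQuot e x y := by
  rw [geomQuot, geomQuot, Finset.mul_sum]
  refine Finset.sum_congr rfl fun r hr => ?_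
  rw [Finset.mem_range] at hr
  obtain ⟨s, hs⟩ : ∃ s, e - 1 = r + s := ⟨e - 1 - r, by omega⟩
  rw [hs, Nat.add_sub_cancel_left]
  ring

theorem map_geomQuot (φ : R →+* S) (e : ℕ) (x y : R) :
    φ (geomQuot e x y) = geomQuot e (φ x) (φ y) := by
  simp [geomQuot]

theorem map_criticalOrbit (φ : R →+* S) (l : ℕ) :
    φ (criticalOrbit p j a b l) = criticalOrbit p j (fun i => φ (a i)) (φ b) l := by
  induction l with
  | zero => simp [criticalOrbit]
  | succ l ih => simp [criticalOrbit, ih]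

theorem map_reducedOrbit (φ : R →+* S) (l : ℕ) :
    φ (reducedOrbit p j a b l) = reducedOrbit p j (fun i => φ (a i)) (φ b) l := by
  induction l with
  | zero => simp [reducedOrbit]
  | succ l ih => simp [reducedOrbit, ih]

theorem map_misiurewicz (φ : R →+* S) (k : ℕ) :
    φ (misiurewicz p j a b k) = misiurewicz p j (fun i => φ (a i)) (φ b) k := by
  simp [misiurewicz, map_geomQuot, map_reducedOrbit]

theorem criticalOrbit_eq_mul (hp : 1 ≤ p) (hj : 1 ≤ j) (l : ℕ) :
    criticalOrbit p j a b l = b * reducedOrbit p j a b l := by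
  induction l with
  | zero => simp [criticalOrbit, reducedOrbit]
  | succ l ih =>
    have h : ∀ e : ℕ, 1 ≤ e → ∀ x : R, (b * x) ^ e = b * (b ^ (e - 1) * x ^ e) := by
      intro e he x
      obtain ⟨e, rfl⟩ := Nat.exists_eq_add_of_le' he
      rw [Nat.add_sub_cancel, mul_pow]; ring
    rw [criticalOrbit, reducedOrbit, ih, mul_add, mul_add, mul_one, h p hp, Finset.mul_sum]
    refine congrArg₂ (· + ·) (congrArg₂ (· + ·) rfl (Finset.sum_congr rfl fun i _ => ?_)) rfl
    rw [h (j + i) (by omega)]; ring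

theorem pow_mul_misiurewicz (hj : 1 ≤ j) (hjp : j ≤ p) (k : ℕ) :
    b ^ (j - 1) * misiurewicz p j a b k =
      geomQuot p (criticalOrbit p j a b (k + 1)) (criticalOrbit p j a b k) +
        ∑ i, a i * geomQuot (j + (i : ℕ)) (criticalOrbit p j a b (k + 1))
          (criticalOrbit p j a b k) := by
  simp only [criticalOrbit_eq_mul p j a b (hj.trans hjp) hj, geomQuot_mul_left]
  rw [misiurewicz, mul_add, ← mul_assoc, ← pow_add, Finset.mul_sum]
  refine congrArg₂ (· + ·) (by rw [show j - 1 + (p - j) = p - 1 by omega])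
    (Finset.sum_congr rfl fun i _ => ?_)
  rw [show j + (i : ℕ) - 1 = j - 1 + i by omega, pow_add]; ring

/-- Each monomial of `f(x) - f(y)` is divisible by `x - y`; the quotients add up to the cofactor,
from which `b ^ (j - 1)` splits off because every orbit point is a multiple of `b`. -/
theorem criticalOrbit_succ_sub (hj : 1 ≤ j) (hjp : j ≤ p) (k : ℕ) :
    criticalOrbit p j a b (k + 2) - criticalOrbit p j a b (k + 1) =
      (criticalOrbit p j a b (k + 1) - criticalOrbit p j a b k) *
        (b ^ (j - 1) * misiurewicz p j a b k) := by
  rw [pow_mul_misiurewicz p j a b hj hjp, mul_comm, add_mul, geomQuot_mul, Finset.sum_mul]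
  simp only [mul_assoc, geomQuot_mul]
  rw [criticalOrbit, criticalOrbit]
  simp only [mul_sub, Finset.sum_sub_distrib]
  ring

/-- At `b = 0` the reduced orbit is `0, 1, 1, ...` and only the `a 0` term survives. Its factor is
`(1^j - 0^j)/(1 - 0) = 1` for `k = 0`, and the derivative `j` of `z^j` at `1` otherwise. -/
theorem misiurewicz_zero [NeZero m] (hj : 2 ≤ j) (hjp : j < p) (k : ℕ) :
    misiurewicz p j a 0 k = (if k = 0 then 1 else (j : R)) * a 0 := by
  have hu : ∀ l, reducedOrbit p j a 0 (l + 1) = 1 := by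
    intro l
    rw [reducedOrbit, zero_pow (by omega), zero_mul, zero_add, Finset.sum_eq_zero, zero_add]
    intro i _
    rw [zero_pow (by omega)]; ring
  rw [misiurewicz, zero_pow (by omega), zero_mul, zero_add, Finset.sum_eq_single (0 : Fin m)]
  · rw [Fin.val_zero, pow_zero, mul_one, add_zero, hu, mul_comm]
    congr 1
    rcases k with _ | k
    · rw [if_pos rfl, geomQuot, reducedOrbit, Finset.sum_eq_single (j - 1)]
      · simp
      · intro r hr hne
        rw [Finset.mem_range] at hr
        rw [zero_pow (by omega), mul_zero]
      · intro h
        rw [Finset.mem_range] at h; omega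
    · rw [if_neg (by omega), hu]
      simp [geomQuot]
  · intro i _ hi
    have : (i : ℕ) ≠ 0 := fun h => hi (Fin.ext (by simpa using h))
    rw [zero_pow this]; ring
  · simp

end Ring

/-! ### Monicity and degrees in `b`. -/

section Degree

variable {A : Type*} [CommRing A] [Nontrivial A]

theorem geomQuot_monic {x y : A[X]} (hx : x.Monic) (hxy : y.natDegree < x.natDegree) (e : ℕ) :
    (geomQuot (e + 1) x y).Monic ∧ (geomQuot (e + 1) x y).natDegree = e * x.natDegree := by
  have hm : (x ^ e).Monic := hx.pow e
  have hd : (x ^ e).natDegree = e * x.natDegree := hx.natDegree_pow e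
  have hlt : (∑ r ∈ Finset.range e, x ^ r * y ^ (e - r)).degree < (x ^ e).degree := by
    rw [degree_eq_natDegree hm.ne_zero, hd]
    refine (degree_sum_le _ _).trans_lt ((Finset.sup_lt_iff (WithBot.bot_lt_coe _)).2 ?_)
    intro r hr
    rw [Finset.mem_range] at hr
    refine degree_le_natDegree.trans_lt (WithBot.coe_lt_coe.2 ?_)
    refine natDegree_mul_le.trans_lt ?_
    rw [hx.natDegree_pow]
    refine (Nat.add_le_add_left natDegree_pow_le _).trans_lt ?_
    have := Nat.mul_lt_mul_of_pos_left hxy (show 0 < e - r by omega)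
    calc _ < r * x.natDegree + (e - r) * x.natDegree := by omega
      _ = e * x.natDegree := by rw [← add_mul, Nat.add_sub_cancel' hr.le]
  have he : geomQuot (e + 1) x y = x ^ e + ∑ r ∈ Finset.range e, x ^ r * y ^ (e - r) := by
    rw [geomQuot, Finset.sum_range_succ]
    simp [add_comm]
  rw [he]
  exact ⟨hm.add_of_left hlt, by rw [natDegree_add_eq_left_of_degree_lt hlt, hd]⟩

variable (p j : ℕ) {m : ℕ} (a : Fin m → A)

theorem criticalOrbit_one {R : Type*} [CommRing R] {p j : ℕ} (hp : 1 ≤ p) (hj : 1 ≤ j)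
    (a : Fin m → R) (b : R) : criticalOrbit p j a b 1 = b := by
  rw [criticalOrbit, criticalOrbit, zero_pow (by omega), zero_add, Finset.sum_eq_zero, zero_add]
  intro i _
  rw [zero_pow (by omega), mul_zero]

theorem criticalOrbit_monic (hj : 1 ≤ j) (hp : 2 ≤ p) (hjm : j + m ≤ p) (l : ℕ) :
    (criticalOrbit p j (fun i => C (a i)) X (l + 1)).Monic ∧
      (criticalOrbit p j (fun i => C (a i)) X (l + 1)).natDegree = p ^ l := by
  induction l with
  | zero =>
    rw [criticalOrbit_one (by omega) hj]
    exact ⟨monic_X, by simp⟩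
  | succ l ih =>
    rw [criticalOrbit]
    set x := criticalOrbit p j (fun i => C (a i)) X (l + 1)
    have hm : (x ^ p).Monic := ih.1.pow p
    have hd : (x ^ p).natDegree = p ^ (l + 1) := by rw [ih.1.natDegree_pow, ih.2]; ring
    have hlt : (∑ i, C (a i) * x ^ (j + (i : ℕ)) + X).degree < (x ^ p).degree := by
      rw [degree_eq_natDegree hm.ne_zero, hd]
      refine (degree_add_le _ _).trans_lt (max_lt ?_ ?_)
      · refine (degree_sum_le _ _).trans_lt ((Finset.sup_lt_iff (WithBot.bot_lt_coe _)).2 ?_)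
        intro i _
        refine degree_le_natDegree.trans_lt (WithBot.coe_lt_coe.2 ?_)
        refine (natDegree_C_mul_le _ _).trans_lt ?_
        rw [ih.1.natDegree_pow, ih.2, pow_succ']
        exact Nat.mul_lt_mul_of_pos_right (by omega) (by positivity)
      · rw [degree_X]
        exact_mod_cast Nat.one_lt_pow (by omega) (by omega)
    rw [add_assoc]
    exact ⟨hm.add_of_left hlt, by rw [natDegree_add_eq_left_of_degree_lt hlt, hd]⟩

theorem natDegree_criticalOrbit_lt (hj : 1 ≤ j) (hp : 2 ≤ p) (hjm : j + m ≤ p) (l : ℕ) :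
    (criticalOrbit p j (fun i => C (a i)) X l).natDegree < p ^ l := by
  rcases l with _ | l
  · simp [criticalOrbit]
  · rw [(criticalOrbit_monic p j a hj hp hjm l).2]
    exact Nat.pow_lt_pow_right (by omega) (by omega)

/-- The quotient coming from `z^p` dominates those from lower powers, and its leading term is
`x_{k+1}^{p-1}`, of degree `(p - 1) p^k`; dividing by `b ^ (j - 1)` preserves monicity. -/
theorem misiurewicz_monic (hj : 1 ≤ j) (hp : 2 ≤ p) (hjp : j ≤ p) (hjm : j + m ≤ p) (k : ℕ) :
    (misiurewicz p j (fun i => C (a i)) X k).Monic ∧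
      (j - 1) + (misiurewicz p j (fun i => C (a i)) X k).natDegree = (p - 1) * p ^ k := by
  have he := pow_mul_misiurewicz p j (fun i => C (a i)) X hj hjp k
  obtain ⟨hx, hxd⟩ := criticalOrbit_monic p j a hj hp hjm k
  have hy := natDegree_criticalOrbit_lt p j a hj hp hjm k
  set x := criticalOrbit p j (fun i => C (a i)) X (k + 1)
  set y := criticalOrbit p j (fun i => C (a i)) X k
  rw [← hxd] at hy
  have hg : ∀ e, 1 ≤ e → (geomQuot e x y).Monic ∧ (geomQuot e x y).natDegree = (e - 1) * p ^ k := by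
    intro e h1
    obtain ⟨e, rfl⟩ := Nat.exists_eq_add_of_le' h1
    rw [← hxd]
    exact geomQuot_monic hx hy e
  obtain ⟨hm, hd⟩ := hg p (by omega)
  have hlt : (∑ i, C (a i) * geomQuot (j + (i : ℕ)) x y).degree < (geomQuot p x y).degree := by
    rw [degree_eq_natDegree hm.ne_zero, hd]
    refine (degree_sum_le _ _).trans_lt ((Finset.sup_lt_iff (WithBot.bot_lt_coe _)).2 ?_)
    intro i _
    refine degree_le_natDegree.trans_lt (WithBot.coe_lt_coe.2 ?_)
    refine (natDegree_C_mul_le _ _).trans_lt ?_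
    rw [(hg _ (by omega)).2]
    exact Nat.mul_lt_mul_of_pos_right (by omega) (by positivity)
  have hM : (X ^ (j - 1) * misiurewicz p j (fun i => C (a i)) X k).Monic := by
    rw [he]; exact hm.add_of_left hlt
  have h := (monic_X_pow (j - 1)).of_mul_monic_left hM
  refine ⟨h, ?_⟩
  rw [← hd, ← natDegree_add_eq_left_of_degree_lt hlt, ← he, (monic_X_pow _).natDegree_mul h,
    natDegree_X_pow]

end Degree

/-! ### Reduction to `z^p + b` in characteristic `p`. -/

section CharP

variable {κ : Type*} [CommRing κ] (p j : ℕ) [Fact p.Prime] [CharP κ p] (m : ℕ)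

/-- Frobenius is additive, so under `z ↦ z^p + b` each difference is the `p`-th power of the
previous one. -/
theorem criticalOrbit_sub_of_charP (l : ℕ) :
    criticalOrbit p j (fun _ : Fin m => (0 : κ[X])) X (l + 1) -
      criticalOrbit p j (fun _ : Fin m => (0 : κ[X])) X l = X ^ p ^ l := by
  induction l with
  | zero =>
    have := (Fact.out : p.Prime).pos.ne'
    simp [criticalOrbit, this]
  | succ l ih =>
    rw [pow_succ, pow_mul, ← ih, sub_pow_char, criticalOrbit, criticalOrbit]
    simp

theorem misiurewicz_of_charP [IsDomain κ] (hj : 1 ≤ j) (hjp : j ≤ p) (k : ℕ) :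
    X ^ (j - 1) * misiurewicz p j (fun _ : Fin m => (0 : κ[X])) X k = X ^ ((p - 1) * p ^ k) := by
  have hp := (Fact.out : p.Prime).pos
  refine mul_right_cancel₀ (b := (X : κ[X]) ^ p ^ k) (pow_ne_zero _ X_ne_zero) ?_
  have h := criticalOrbit_succ_sub p j (fun _ : Fin m => (0 : κ[X])) X hj hjp k
  rw [criticalOrbit_sub_of_charP, criticalOrbit_sub_of_charP] at h
  rw [mul_comm, ← h, ← pow_add, ← add_one_mul,
    Nat.sub_add_cancel (show 1 ≤ p from hp), pow_succ']

end CharP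

/-! ### Irreducibility: Eisenstein over the algebraic integers, then passage to `ℂ`. -/

/-- Eisenstein's criterion at the prime generated by `P` and all the variables `a i`, which is the
kernel of `φ` below. -/
theorem misiurewicz_irreducible_of_mem {O : Type*} [CommRing O] [IsDomain O] {P : Ideal O}
    [P.IsPrime] {p j m : ℕ} [Fact p.Prime] [NeZero m] (hP : (p : O) ∈ P) (hj : 2 ≤ j) (hjp : j < p)
    (hjm : j + m ≤ p) (k : ℕ) :
    Irreducible (misiurewicz p j (fun i : Fin m => C (MvPolynomial.X i : MvPolynomial (Fin m) O))
      X k) := by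
  have hpp : p.Prime := Fact.out
  have : CharP (O ⧸ P) p := (CharP.charP_iff_prime_eq_zero hpp).2 (by
    rw [← map_natCast (Ideal.Quotient.mk P), Ideal.Quotient.eq_zero_iff_mem]; exact hP)
  have hjP : (j : O ⧸ P) ≠ 0 := by
    rw [Ne, CharP.cast_eq_zero_iff (O ⧸ P) p]
    exact fun h => absurd (Nat.le_of_dvd (by omega) h) (by omega)
  set H := misiurewicz p j (fun i : Fin m => C (MvPolynomial.X i : MvPolynomial (Fin m) O)) X k
    with hH
  obtain ⟨hm, hd⟩ := misiurewicz_monic p j (fun i : Fin m => (MvPolynomial.X i :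
    MvPolynomial (Fin m) O)) (by omega) hpp.two_le hjp.le hjm k
  rw [← hH] at hm hd
  have hpos : 0 < H.natDegree := by
    have : (p - 1) * 1 ≤ (p - 1) * p ^ k := Nat.mul_le_mul_left _ (Nat.one_le_pow _ _ hpp.pos)
    omega
  let φ : MvPolynomial (Fin m) O →+* O ⧸ P := (Ideal.Quotient.mk P).comp MvPolynomial.constantCoeff
  have hφX : ∀ i, φ (MvPolynomial.X i) = 0 := fun i => by simp [φ]
  have hmap : H.map φ = X ^ H.natDegree := by
    have h1 : H.map φ = misiurewicz p j (fun _ : Fin m => (0 : (O ⧸ P)[X])) X k := by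
      rw [← coe_mapRingHom, hH, map_misiurewicz]
      simp [hφX]
    have h2 := misiurewicz_of_charP (κ := O ⧸ P) p j m (by omega) hjp.le k
    rw [← h1, ← hd, pow_add] at h2
    exact mul_left_cancel₀ (pow_ne_zero _ X_ne_zero) h2
  -- Keeping `a 0` as a variable detects the square of the prime: `ψ` maps `ker φ` into `(X)`, hence
  -- its square into `(X²)`, whereas the constant term becomes `X` or `j X` with `j ≠ 0` modulo `P`.
  let ψ : MvPolynomial (Fin m) O →+* (O ⧸ P)[X] :=
    MvPolynomial.eval₂Hom (C.comp (Ideal.Quotient.mk P)) (fun i => if i = 0 then X else 0)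
  have hψφ : ∀ f, (ψ f).coeff 0 = φ f := by
    intro f
    have : (constantCoeff.comp ψ : MvPolynomial (Fin m) O →+* O ⧸ P) = φ := by
      refine MvPolynomial.ringHom_ext (fun r => by simp [ψ, φ]) (fun i => ?_)
      by_cases h : i = 0 <;> simp [ψ, φ, h]
    exact congrArg (fun g => g f) this
  have hker : RingHom.ker φ ≤ (Ideal.span {X}).comap ψ := by
    intro f hf
    rw [RingHom.mem_ker] at hf
    rw [Ideal.mem_comap, Ideal.mem_span_singleton, X_dvd_iff, hψφ, hf]
  refine irreducible_of_eisenstein_criterion (P := RingHom.ker φ) (RingHom.ker_isPrime φ)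
    ?_ ?_ (natDegree_pos_iff_degree_pos.1 hpos) ?_ hm.isPrimitive
  · rw [hm.leadingCoeff, RingHom.mem_ker, map_one]; exact one_ne_zero
  · intro n hn
    have hn' : n < H.natDegree := by
      rw [degree_eq_natDegree hm.ne_zero] at hn
      exact_mod_cast hn
    rw [RingHom.mem_ker, ← coeff_map, hmap, coeff_X_pow, if_neg hn'.ne]
  · intro h
    have h2 := (Ideal.pow_right_mono hker 2).trans (Ideal.le_comap_pow ψ 2) h
    rw [Ideal.mem_comap, Ideal.span_singleton_pow, Ideal.mem_span_singleton, X_pow_dvd_iff] at h2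
    have h3 := h2 1 one_lt_two
    rw [coeff_zero_eq_eval_zero, ← coe_evalRingHom, hH, map_misiurewicz] at h3
    simp only [coe_evalRingHom, eval_C, eval_X] at h3
    rw [misiurewicz_zero p j _ hj hjp, map_mul] at h3
    have h4 : ψ (MvPolynomial.X 0) = X := by simp [ψ]
    rw [h4, coeff_mul_X] at h3
    split_ifs at h3 with hk
    · simp at h3
    · rw [map_natCast, coeff_natCast_ite, if_pos rfl] at h3
      exact hjP h3

/-- Coefficients of a monic factor of a monic polynomial over `A` are integral over `A`, hence
already lie in `A`. Any monic factorization over `B` thus descends. -/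
theorem irreducible_map_of_isIntegrallyClosedIn {A B : Type*} [CommRing A] [CommRing B] [IsDomain A]
    [IsDomain B] [Algebra A B] (hinj : Function.Injective (algebraMap A B))
    (hint : ∀ x : B, IsIntegral A x → x ∈ (algebraMap A B).range) {H : A[X]} (hm : H.Monic)
    (hH : Irreducible H) : Irreducible (H.map (algebraMap A B)) := by
  have hlift : ∀ f : B[X], f.Monic → f ∣ H.map (algebraMap A B) →
      ∃ F : A[X], F.map (algebraMap A B) = f := fun f hf hd => by
    have : f ∈ lifts (algebraMap A B) := by
      rw [lifts_iff_coeff_lifts]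
      exact fun n => hint _ (isIntegral_coeff_of_dvd H f hm hf hd n)
    exact (mem_lifts f).1 this
  refine (irreducible_of_monic (hm.map _) fun h => hH.1 ?_).2 fun f g hf hg hfg => ?_
  · rw [map_injective _ hinj (h.trans (Polynomial.map_one _).symm)]; exact isUnit_one
  · obtain ⟨F, rfl⟩ := hlift f hf ⟨g, hfg.symm⟩
    obtain ⟨G, rfl⟩ := hlift g hg ⟨_, by rw [mul_comm, hfg]⟩
    rw [← Polynomial.map_mul] at hfg
    have hFG := map_injective _ hinj hfg
    rcases hH.isUnit_or_isUnit hFG.symm with h | h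
    · left; exact hf.eq_one_of_isUnit (h.map (mapRingHom (algebraMap A B)))
    · right; exact hg.eq_one_of_isUnit (h.map (mapRingHom (algebraMap A B)))

theorem irreducible_map_mvPolynomial {A B σ : Type*} [CommRing A] [CommRing B] [IsDomain A]
    [IsDomain B] [Algebra A B] (hinj : Function.Injective (algebraMap A B))
    (hint : ∀ x : B, IsIntegral A x → x ∈ Set.range (algebraMap A B)) {H : (MvPolynomial σ A)[X]}
    (hm : H.Monic) (hH : Irreducible H) :
    Irreducible (H.map (MvPolynomial.map (algebraMap A B))) := by
  let _ : Algebra (MvPolynomial σ A) (MvPolynomial σ B) := MvPolynomial.algebraMvPolynomial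
  refine irreducible_map_of_isIntegrallyClosedIn (B := MvPolynomial σ B)
    (MvPolynomial.map_injective _ hinj) (fun x hx => ?_) hm hH
  change x ∈ Set.range (MvPolynomial.map (algebraMap A B))
  rw [MvPolynomial.mem_range_map_iff_coeffs_subset]
  intro c hc
  obtain ⟨n, -, rfl⟩ := MvPolynomial.mem_coeffs_iff.1 hc
  exact hint _ (MvPolynomial.isIntegral_iff_isIntegral_coeff.1 hx n)

theorem misiurewicz_irreducible {p j m : ℕ} [Fact p.Prime] [NeZero m] (hj : 2 ≤ j) (hjp : j < p)
    (hjm : j + m ≤ p) (k : ℕ) :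
    Irreducible (misiurewicz p j (fun i : Fin m => C (MvPolynomial.X i : MvPolynomial (Fin m) ℂ))
      X k) := by
  have hpp : p.Prime := Fact.out
  let O := integralClosure ℤ ℂ
  have : (Ideal.span {(p : ℤ)}).IsPrime :=
    (Ideal.span_singleton_prime (by exact_mod_cast hpp.ne_zero)).2 (Nat.prime_iff_prime_int.1 hpp)
  -- Lying over supplies a prime of the ring of all algebraic integers above `p`.
  obtain ⟨P, -, hPp, hP⟩ := Ideal.exists_ideal_over_prime_of_isIntegral (S := O)
    (Ideal.span {(p : ℤ)}) ⊥ (by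
      intro x hx
      rw [Ideal.mem_comap, Ideal.mem_bot] at hx
      have := (FaithfulSMul.algebraMap_injective ℤ O) (hx.trans (map_zero _).symm)
      rw [this]; exact Ideal.zero_mem _)
  have hmem : (p : O) ∈ P := by
    have : (p : ℤ) ∈ P.comap (algebraMap ℤ O) := by rw [hP]; exact Ideal.mem_span_singleton_self _
    simpa using this
  have h := misiurewicz_irreducible_of_mem hmem hj hjp hjm k
  have hinj : Function.Injective (algebraMap O ℂ) := FaithfulSMul.algebraMap_injective O ℂ
  have h2 := irreducible_map_mvPolynomial (B := ℂ) hinj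
    (fun x hx => ⟨⟨x, isIntegral_trans (R := ℤ) _ hx⟩, rfl⟩)
    (misiurewicz_monic p j _ (by omega) hpp.two_le hjp.le hjm k).1 h
  rw [← coe_mapRingHom, map_misiurewicz] at h2
  simpa using h2

/-! ### The locus in `(a, b)`-space and the Nullstellensatz. -/

/-- Evaluation of a polynomial in `b` over the polynomials in `a` at a point `(a, b)`. -/
noncomputable def evalAt {σ : Type*} (a : σ → ℂ) (b : ℂ) : (MvPolynomial σ ℂ)[X] →+* ℂ :=
  eval₂RingHom (MvPolynomial.eval a) b

section

variable {σ : Type*} (a : σ → ℂ) (b : ℂ)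

@[simp]
theorem evalAt_X : evalAt a b X = b := by simp [evalAt]

@[simp]
theorem evalAt_C (q : MvPolynomial σ ℂ) : evalAt a b (C q) = MvPolynomial.eval a q := by
  simp [evalAt]

theorem evalAt_eq_eval (f : (MvPolynomial σ ℂ)[X]) :
    evalAt a b f = MvPolynomial.eval (fun x => Option.elim x b a)
      ((MvPolynomial.optionEquivLeft ℂ σ).symm f) := by
  rw [MvPolynomial.optionEquivLeft_elim_eval, AlgEquiv.apply_symm_apply, evalAt,
    coe_eval₂RingHom, eval₂_eq_eval_map]

end

/-- An irreducible polynomial generates a prime ideal, which is radical, so the Nullstellensatz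
turns vanishing on the hypersurface into divisibility. -/
theorem dvd_of_forall_evalAt {σ : Type*} [Finite σ] {H Q : (MvPolynomial σ ℂ)[X]}
    (hH : Irreducible H) (h : ∀ a b, evalAt a b H = 0 → evalAt a b Q = 0) : H ∣ Q := by
  have hp : Prime ((MvPolynomial.optionEquivLeft ℂ σ).symm H) :=
    (MulEquiv.prime_iff (MvPolynomial.optionEquivLeft ℂ σ).symm).2 hH.prime
  have : (Ideal.span {(MvPolynomial.optionEquivLeft ℂ σ).symm H}).IsPrime :=
    (Ideal.span_singleton_prime hp.ne_zero).2 hp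
  have hQ : (MvPolynomial.optionEquivLeft ℂ σ).symm Q ∈
      Ideal.span {(MvPolynomial.optionEquivLeft ℂ σ).symm H} := by
    rw [← MvPolynomial.IsPrime.vanishingIdeal_zeroLocus (K := ℂ)
      (Ideal.span {(MvPolynomial.optionEquivLeft ℂ σ).symm H}),
      MvPolynomial.mem_vanishingIdeal_iff]
    intro x hx
    have hx' := hx _ (Ideal.mem_span_singleton_self _)
    have e : x = fun o => Option.elim o (x none) (fun i => x (some i)) := by
      ext o; cases o <;> rfl
    rw [MvPolynomial.aeval_eq_eval] at hx' ⊢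
    rw [e, ← evalAt_eq_eval] at hx' ⊢
    exact h _ _ hx'
  rw [Ideal.mem_span_singleton] at hQ
  exact (map_dvd_iff (MvPolynomial.optionEquivLeft ℂ σ).symm).1 hQ

/-- The variables `a i` as polynomials in `b` over the polynomials in `a`. -/
noncomputable def genericCoeff (m : ℕ) : Fin m → (MvPolynomial (Fin m) ℂ)[X] :=
  fun i => C (MvPolynomial.X i)

/-- The equation in `(a, b)` for the critical point to be strictly `(k, 1)`-preperiodic. -/
noncomputable def sliceEquation (p j m k : ℕ) : (MvPolynomial (Fin m) ℂ)[X] :=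
  match k with
  | 0 => X
  | k + 1 => misiurewicz p j (genericCoeff m) X k

/-- The inequation in `(a, b)` for strict `(k, 1)`-preperiodicity and ramification index `j`. -/
noncomputable def sliceInequation (p j m : ℕ) [NeZero m] (k : ℕ) : (MvPolynomial (Fin m) ℂ)[X] :=
  match k with
  | 0 => C (MvPolynomial.X 0)
  | k + 1 => C (MvPolynomial.X 0) *
      (criticalOrbit p j (genericCoeff m) X (k + 1) -
        criticalOrbit p j (genericCoeff m) X k)

/-- The parameters `(a, b)` for which `0` is a critical point of ramification index `j` of
`X ^ p + ∑ i, a i * X ^ (j + i) + b` and is strictly `(k, 1)`-preperiodic. -/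
def slice (p j m : ℕ) [NeZero m] (k : ℕ) : Set ((Fin m → ℂ) × ℂ) :=
  {y | y.1 0 ≠ 0 ∧ criticalOrbit p j y.1 y.2 (k + 1) = criticalOrbit p j y.1 y.2 k ∧
    ∀ l < k, criticalOrbit p j y.1 y.2 (l + 1) ≠ criticalOrbit p j y.1 y.2 l}

section

variable {p j m : ℕ}

theorem criticalOrbit_zero {R : Type*} [CommRing R] (a : Fin m → R) (b : R) :
    criticalOrbit p j a b 0 = 0 := rfl

theorem sliceEquation_monic (hp : 2 ≤ p) (hj : 1 ≤ j) (hjp : j ≤ p) (hjm : j + m ≤ p) (k : ℕ) :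
    (sliceEquation p j m k).Monic := by
  rcases k with _ | k
  · exact monic_X
  · exact (misiurewicz_monic p j _ hj hp hjp hjm k).1

theorem natDegree_misiurewicz_genericCoeff (hp : 2 ≤ p) (hj : 1 ≤ j) (hjp : j ≤ p)
    (hjm : j + m ≤ p) (k : ℕ) :
    (j - 1) + (misiurewicz p j (genericCoeff m) X k).natDegree = (p - 1) * p ^ k :=
  (misiurewicz_monic p j _ hj hp hjp hjm k).2

theorem sliceEquation_natDegree_pos (hp : 2 ≤ p) (hj : 1 ≤ j) (hjp : j < p) (hjm : j + m ≤ p)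
    (k : ℕ) : 0 < (sliceEquation p j m k).natDegree := by
  rcases k with _ | k
  · simp [sliceEquation]
  · have h := natDegree_misiurewicz_genericCoeff hp hj hjp.le hjm k
    have : (p - 1) * 1 ≤ (p - 1) * p ^ k := Nat.mul_le_mul_left _ (Nat.one_le_pow _ _ (by omega))
    change 0 < (misiurewicz p j (genericCoeff m) X k).natDegree
    omega

theorem sliceEquation_irreducible [Fact p.Prime] [NeZero m] (hj : 2 ≤ j) (hjp : j < p)
    (hjm : j + m ≤ p) (k : ℕ) : Irreducible (sliceEquation p j m k) := by
  rcases k with _ | k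
  · exact irreducible_X
  · exact misiurewicz_irreducible hj hjp hjm k

theorem criticalOrbit_sub_dvd_of_le {R : Type*} [CommRing R] {a : Fin m → R} {b : R} (hj : 1 ≤ j)
    (hjp : j ≤ p) {l k : ℕ} (hlk : l ≤ k) :
    criticalOrbit p j a b (l + 1) - criticalOrbit p j a b l ∣
      criticalOrbit p j a b (k + 1) - criticalOrbit p j a b k := by
  induction k, hlk using Nat.le_induction with
  | base => exact dvd_rfl
  | succ k _ ih =>
    rw [criticalOrbit_succ_sub p j a b hj hjp]
    exact ih.mul_right _

/-- The difference is `b` times factors `b ^ (j - 1)` and earlier cofactors. The prime `H_k` does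
not divide `b`, since its value at `b = 0` is nonzero, and it has larger degree than the monic
earlier cofactors. -/
theorem misiurewicz_not_dvd [Fact p.Prime] [NeZero m] (hj : 2 ≤ j) (hjp : j < p)
    (hjm : j + m ≤ p) {k l : ℕ} (hlk : l ≤ k) :
    ¬ misiurewicz p j (genericCoeff m) X k ∣
      criticalOrbit p j (genericCoeff m) X (l + 1)
      - criticalOrbit p j (genericCoeff m) X l := by
  have hp := (Fact.out : p.Prime).two_le
  have hprime : Prime (misiurewicz p j (genericCoeff m) X k) :=
    (misiurewicz_irreducible hj hjp hjm k).prime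
  have hX : ¬ misiurewicz p j (genericCoeff m) X k ∣
      X := by
    intro h
    have h2 : (X : (MvPolynomial (Fin m) ℂ)[X]) ∣
        misiurewicz p j (genericCoeff m) X k :=
      ((misiurewicz_irreducible hj hjp hjm k).associated_of_dvd irreducible_X h).symm.dvd
    rw [X_dvd_iff, coeff_zero_eq_eval_zero, ← coe_evalRingHom, map_misiurewicz] at h2
    simp only [genericCoeff, coe_evalRingHom, eval_C, eval_X] at h2
    rw [misiurewicz_zero p j _ hj hjp] at h2
    have := congrArg (MvPolynomial.eval 1) h2
    have hj0 : (j : ℂ) ≠ 0 := by exact_mod_cast (by omega : j ≠ 0)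
    by_cases hk : k = 0
    · simp [hk] at this
    · simp [hk, hj0] at this
  induction l with
  | zero =>
    rw [criticalOrbit_one (by omega) (by omega), criticalOrbit_zero, sub_zero]
    exact hX
  | succ l ih =>
    rw [criticalOrbit_succ_sub p j _ _ (by omega) hjp.le]
    intro h
    rcases hprime.dvd_or_dvd h with h | h
    · exact ih (by omega) h
    · rcases hprime.dvd_or_dvd h with h | h
      · exact hX (hprime.dvd_of_dvd_pow h)
      · have hm : (misiurewicz p j (genericCoeff m) X l).Monic :=
          (misiurewicz_monic p j _ (by omega) hp hjp.le hjm l).1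
        have hd := natDegree_misiurewicz_genericCoeff hp (by omega) hjp.le hjm l
        have hd' := natDegree_misiurewicz_genericCoeff hp (by omega) hjp.le hjm k
        have hle := natDegree_le_of_dvd h hm.ne_zero
        have hlt : (p - 1) * p ^ l < (p - 1) * p ^ k :=
          Nat.mul_lt_mul_of_pos_left (Nat.pow_lt_pow_right hp (by omega)) (by omega)
        omega

theorem sliceEquation_not_dvd_C [Fact p.Prime] (hj : 2 ≤ j) (hjp : j < p)
    (hjm : j + m ≤ p) (k : ℕ) {c : MvPolynomial (Fin m) ℂ} (hc : c ≠ 0) :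
    ¬ sliceEquation p j m k ∣ C c := by
  have hp := (Fact.out : p.Prime).two_le
  intro h
  have h1 := natDegree_le_of_dvd h (C_ne_zero.2 hc)
  have h2 := sliceEquation_natDegree_pos hp (by omega) hjp hjm k
  rw [natDegree_C] at h1
  omega

theorem sliceEquation_not_dvd_sliceInequation [Fact p.Prime] [NeZero m] (hj : 2 ≤ j) (hjp : j < p)
    (hjm : j + m ≤ p) (k : ℕ) : ¬ sliceEquation p j m k ∣ sliceInequation p j m k := by
  have hX : (MvPolynomial.X 0 : MvPolynomial (Fin m) ℂ) ≠ 0 := MvPolynomial.X_ne_zero 0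
  rcases k with _ | k
  · exact sliceEquation_not_dvd_C hj hjp hjm 0 hX
  · intro h
    rcases (sliceEquation_irreducible hj hjp hjm (k + 1)).prime.dvd_or_dvd h with h | h
    · exact sliceEquation_not_dvd_C hj hjp hjm _ hX h
    · exact misiurewicz_not_dvd hj hjp hjm le_rfl h

/-- Only the last inequality is needed, since earlier differences divide later ones. The factor `b ^
(j - 1)` cannot vanish there: `b = 0` makes the whole orbit `0`. -/
theorem mem_slice_iff [NeZero m] (hj : 2 ≤ j) (hjp : j < p) (k : ℕ) (y : (Fin m → ℂ) × ℂ) :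
    y ∈ slice p j m k ↔ evalAt y.1 y.2 (sliceEquation p j m k) = 0 ∧
      evalAt y.1 y.2 (sliceInequation p j m k) ≠ 0 := by
  obtain ⟨a, b⟩ := y
  have hp1 : 1 ≤ p := by omega
  have hj1 : 1 ≤ j := by omega
  rcases k with _ | k
  · simp [slice, sliceEquation, sliceInequation, criticalOrbit_one hp1 hj1, criticalOrbit_zero,
      and_comm]
  · simp only [slice, sliceEquation, sliceInequation, Set.mem_ofPred_eq, map_mul, map_sub,
      map_criticalOrbit, map_misiurewicz, genericCoeff, evalAt_X, evalAt_C, MvPolynomial.eval_X,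
      mul_ne_zero_iff, sub_ne_zero]
    have hs := criticalOrbit_succ_sub p j a b hj1 hjp.le k
    constructor
    · rintro ⟨h0, h1, h2⟩
      have h3 := h2 k (by omega)
      refine ⟨?_, h0, h3⟩
      rw [h1, sub_self, eq_comm, mul_eq_zero, mul_eq_zero, or_iff_right (sub_ne_zero.2 h3)] at hs
      refine hs.resolve_left fun hb => h3 ?_
      have hb' : b = 0 := eq_zero_of_pow_eq_zero hb
      rw [criticalOrbit_eq_mul p j a b hp1 hj1, criticalOrbit_eq_mul p j a b hp1 hj1, hb',
        zero_mul, zero_mul]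
    · rintro ⟨h, h0, h3⟩
      refine ⟨h0, ?_, fun l hl h4 => h3 ?_⟩
      · rw [h, mul_zero, mul_zero] at hs
        exact sub_eq_zero.1 hs
      · have := criticalOrbit_sub_dvd_of_le (p := p) (j := j) (a := a) (b := b) hj1 hjp.le
          (show l ≤ k by omega)
        rw [h4, sub_self, zero_dvd_iff] at this
        exact sub_eq_zero.1 this

/-- Otherwise the equation would divide the product of the inequation and `c`. With `c = 1` this is
nonemptiness; in general the coordinates `a` satisfy no polynomial relation on the slice. -/
theorem exists_mem_slice [Fact p.Prime] [NeZero m] (hj : 2 ≤ j) (hjp : j < p)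
    (hjm : j + m ≤ p) (k : ℕ) {c : MvPolynomial (Fin m) ℂ} (hc : c ≠ 0) :
    ∃ y ∈ slice p j m k, MvPolynomial.eval y.1 c ≠ 0 := by
  by_contra! h
  have hirr := sliceEquation_irreducible hj hjp hjm k
  have : sliceEquation p j m k ∣ sliceInequation p j m k * C c := by
    refine dvd_of_forall_evalAt hirr fun a b hab => ?_
    by_cases hE : evalAt a b (sliceInequation p j m k) = 0
    · rw [map_mul, hE, zero_mul]
    · rw [map_mul, evalAt_C, h (a, b) ((mem_slice_iff hj hjp k _).2 ⟨hab, hE⟩), mul_zero]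
  rcases hirr.prime.dvd_or_dvd this with h1 | h1
  · exact sliceEquation_not_dvd_sliceInequation hj hjp hjm k h1
  · exact sliceEquation_not_dvd_C hj hjp hjm k hc h1

theorem slice_eq_zero_or_eq_zero [Fact p.Prime] [NeZero m] (hj : 2 ≤ j) (hjp : j < p)
    (hjm : j + m ≤ p) (k : ℕ) {P Q : (MvPolynomial (Fin m) ℂ)[X]}
    (h : ∀ y ∈ slice p j m k, evalAt y.1 y.2 P * evalAt y.1 y.2 Q = 0) :
    (∀ y ∈ slice p j m k, evalAt y.1 y.2 P = 0) ∨ ∀ y ∈ slice p j m k, evalAt y.1 y.2 Q = 0 := by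
  have hirr := sliceEquation_irreducible hj hjp hjm k
  have hz : ∀ P : (MvPolynomial (Fin m) ℂ)[X], sliceEquation p j m k ∣ P →
      ∀ y ∈ slice p j m k, evalAt y.1 y.2 P = 0 := by
    rintro P ⟨R, rfl⟩ y hy
    rw [map_mul, ((mem_slice_iff hj hjp k y).1 hy).1, zero_mul]
  have : sliceEquation p j m k ∣ sliceInequation p j m k * (P * Q) := by
    refine dvd_of_forall_evalAt hirr fun a b hab => ?_
    by_cases hE : evalAt a b (sliceInequation p j m k) = 0
    · rw [map_mul, hE, zero_mul]
    · rw [map_mul, map_mul, h (a, b) ((mem_slice_iff hj hjp k _).2 ⟨hab, hE⟩), mul_zero]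
  rcases hirr.prime.dvd_or_dvd this with h1 | h1
  · exact absurd h1 (sliceEquation_not_dvd_sliceInequation hj hjp hjm k)
  · exact (hirr.prime.dvd_or_dvd h1).imp (hz P) (hz Q)

end

/-! ### Normalized representatives and conjugation invariance. -/

/-- A marked polynomial is normalized if it is monic and marked at `0`. -/
def MarkedPoly.IsNormalized {d : ℕ} (F : MarkedPoly d) : Prop :=
  F.poly.Monic ∧ F.point = 0

/-- The class of a marked polynomial in the moduli space. -/
def MarkedPoly.toModuli {d : ℕ} (F : MarkedPoly d) : Moduli d :=
  Quotient.mk (markedPolySetoid d) F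

theorem MarkedPoly.toModuli_eq_iff {d : ℕ} {F G : MarkedPoly d} :
    F.toModuli = G.toModuli ↔ AffineConj F G :=
  Quotient.eq (r := markedPolySetoid d)

theorem MarkedPoly.ext' {d : ℕ} {F G : MarkedPoly d} (h : F.poly = G.poly)
    (h' : F.point = G.point) : F = G := by
  cases F; cases G; cases h; cases h'; rfl

theorem exists_isNormalized {d : ℕ} (hd : 2 ≤ d) (m : Moduli d) :
    ∃ F : MarkedPoly d, F.IsNormalized ∧ F.toModuli = m := by
  induction m using Quotient.inductionOn with
  | _ F =>
  have hF : F.poly ≠ 0 := fun h => by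
    have := F.natDegree_eq
    rw [h, natDegree_zero] at this; omega
  -- Conjugation by `h(z) = a (z - c)` divides the leading coefficient by `a ^ (d - 1)`.
  obtain ⟨a, ha⟩ := IsAlgClosed.exists_pow_nat_eq F.poly.leadingCoeff (n := d - 1) (by omega)
  have ha0 : a ≠ 0 := by
    rintro rfl
    rw [zero_pow (by omega)] at ha
    exact hF (leadingCoeff_eq_zero.1 ha.symm)
  let q : ℂ[X] := C a⁻¹ * X + C F.point
  have hq : q.natDegree = 1 := natDegree_linear (inv_ne_zero ha0)
  have hql : q.leadingCoeff = a⁻¹ := leadingCoeff_linear (inv_ne_zero ha0)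
  have hcd : (F.poly.comp q).natDegree = d := by rw [natDegree_comp, hq, F.natDegree_eq, mul_one]
  have hlt : (C F.point).natDegree < (F.poly.comp q).natDegree := by
    rw [hcd, natDegree_C]; omega
  have hdeg : (C a * (F.poly.comp q - C F.point)).natDegree = d := by
    rw [natDegree_C_mul ha0, natDegree_sub_eq_left_of_natDegree_lt hlt, hcd]
  refine ⟨⟨C a * (F.poly.comp q - C F.point), 0, hdeg, ?_⟩, ⟨?_, rfl⟩, ?_⟩
  · simp [derivative_comp, q, F.isCritical]
  · have hl : (F.poly.comp q - C F.point).leadingCoeff = (F.poly.comp q).leadingCoeff :=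
      leadingCoeff_sub_of_degree_lt (degree_lt_degree hlt)
    change (C a * (F.poly.comp q - C F.point)).leadingCoeff = 1
    rw [leadingCoeff_mul, leadingCoeff_C, hl, leadingCoeff_comp (by omega), hql, ← ha,
      F.natDegree_eq]
    obtain ⟨e, rfl⟩ := Nat.exists_eq_add_of_le' (show 1 ≤ d by omega)
    rw [Nat.add_sub_cancel, inv_pow]
    field_simp
    ring
  · change MarkedPoly.toModuli _ = MarkedPoly.toModuli F
    rw [eq_comm, MarkedPoly.toModuli_eq_iff]
    refine ⟨a, -(a * F.point), ha0, fun z => ?_, by simp⟩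
    have : a⁻¹ * (a * z + -(a * F.point)) + F.point = z := by field_simp; ring
    simp only [eval_mul, eval_C, eval_sub, eval_comp, q, eval_add, eval_X, this]
    ring

/-- Fixing the marked point `0` removes the translation, and comparing leading coefficients makes
the scaling a root of unity. -/
theorem MarkedPoly.IsNormalized.exists_of_affineConj {d : ℕ} (hd : 2 ≤ d) {F G : MarkedPoly d}
    (hF : F.IsNormalized) (hG : G.IsNormalized) (h : AffineConj F G) :
    ∃ ζ : ℂ, ζ ^ (d - 1) = 1 ∧ (∀ z, G.poly.eval (ζ * z) = ζ * F.poly.eval z) ∧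
      ∀ i, G.poly.coeff i * ζ ^ i = ζ * F.poly.coeff i := by
  obtain ⟨ζ, b, hζ, h, hp⟩ := h
  obtain rfl : b = 0 := by
    rw [hF.2, hG.2] at hp
    simpa using hp.symm
  simp only [add_zero] at h
  have he : G.poly.comp (C ζ * X) = C ζ * F.poly := by
    refine Polynomial.funext fun z => ?_
    simp [h]
  have hc : ∀ i, G.poly.coeff i * ζ ^ i = ζ * F.poly.coeff i := fun i => by
    rw [← coeff_C_mul, ← he, comp_C_mul_X_coeff]
  refine ⟨ζ, ?_, h, hc⟩
  have h1 := hc d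
  have h2 : F.poly.coeff d = 1 := by
    have := hF.1.coeff_natDegree; rwa [F.natDegree_eq] at this
  have h3 : G.poly.coeff d = 1 := by
    have := hG.1.coeff_natDegree; rwa [G.natDegree_eq] at this
  obtain ⟨e, rfl⟩ := Nat.exists_eq_add_of_le' (show 1 ≤ d by omega)
  rw [h2, h3, one_mul, pow_succ, mul_comm] at h1
  rw [Nat.add_sub_cancel]
  exact mul_left_cancel₀ hζ h1

theorem AffineConj.exists_iterate_eq {d : ℕ} {F G : MarkedPoly d} (h : AffineConj F G) :
    ∃ a b : ℂ, a ≠ 0 ∧ ∀ l, (fun z => G.poly.eval z)^[l] G.point =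
      a * (fun z => F.poly.eval z)^[l] F.point + b := by
  obtain ⟨a, b, ha, h, hp⟩ := h
  refine ⟨a, b, ha, fun l => ?_⟩
  induction l with
  | zero => exact hp
  | succ l ih => rw [Function.iterate_succ_apply', Function.iterate_succ_apply', ih, h]

theorem AffineConj.isStrictlyPreperiodic {d : ℕ} {F G : MarkedPoly d} (h : AffineConj F G)
    {k n : ℕ} (hF : IsStrictlyPreperiodic (fun z => F.poly.eval z) k n F.point) :
    IsStrictlyPreperiodic (fun z => G.poly.eval z) k n G.point := by
  obtain ⟨a, b, ha, h⟩ := h.exists_iterate_eq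
  have hiff : ∀ l l' : ℕ, (fun z => G.poly.eval z)^[l] G.point =
      (fun z => G.poly.eval z)^[l'] G.point ↔ (fun z => F.poly.eval z)^[l] F.point =
      (fun z => F.poly.eval z)^[l'] F.point := fun l l' => by
    rw [h, h, add_left_inj, mul_right_inj' ha]
  refine ⟨(hiff _ _).2 hF.1, fun l m h1 h2 h3 h4 => ?_⟩
  rw [Ne, hiff]
  exact hF.2 l m h1 h2 h3 h4

theorem AffineConj.ramificationIndex_le {d : ℕ} (hd : 1 ≤ d) {F G : MarkedPoly d}
    (h : AffineConj F G) : G.ramificationIndex ≤ F.ramificationIndex := by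
  obtain ⟨a, b, ha, h, hp⟩ := h
  have hF0 : F.poly - C (F.poly.eval F.point) ≠ 0 := fun h0 => by
    have h1 := congrArg natDegree (sub_eq_zero.1 h0)
    rw [F.natDegree_eq, natDegree_C] at h1; omega
  have he : (G.poly - C (G.poly.eval G.point)).comp (C a * X + C b) =
      C a * (F.poly - C (F.poly.eval F.point)) := by
    refine Polynomial.funext fun z => ?_
    simp only [eval_comp, eval_sub, eval_C, eval_add, eval_mul, eval_X, h, hp]
    ring
  rw [MarkedPoly.ramificationIndex, MarkedPoly.ramificationIndex, le_rootMultiplicity_iff hF0]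
  obtain ⟨R, hR⟩ := pow_rootMultiplicity_dvd (G.poly - C (G.poly.eval G.point)) G.point
  have h1 : (X - C G.point).comp (C a * X + C b) = C a * (X - C F.point) := by
    rw [hp, sub_comp, X_comp, C_comp, C_add, C_mul]
    ring
  have h2 := congrArg (fun f => f.comp (C a * X + C b)) hR
  simp only [mul_comp, pow_comp] at h2
  rw [he, h1, mul_pow] at h2
  refine (isUnit_C.2 (isUnit_iff_ne_zero.2 ha)).dvd_mul_left.1 
    ⟨C a ^ rootMultiplicity G.point (G.poly - C (G.poly.eval G.point)) *
      R.comp (C a * X + C b), by rw [h2]; ring⟩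

theorem AffineConj.ramificationIndex_eq {d : ℕ} (hd : 1 ≤ d) {F G : MarkedPoly d}
    (h : AffineConj F G) : G.ramificationIndex = F.ramificationIndex :=
  (h.ramificationIndex_le hd).antisymm
    (((affineConj_equivalence d).symm h).ramificationIndex_le hd)

theorem toModuli_mem_preperiodicLocus {d : ℕ} (hd : 1 ≤ d) {k n j : ℕ} {F : MarkedPoly d} :
    F.toModuli ∈ preperiodicLocus d k n j ↔
      IsStrictlyPreperiodic (fun z => F.poly.eval z) k n F.point ∧ F.ramificationIndex = j := by
  constructor
  · rintro ⟨G, hG, h1, h2⟩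
    have h : AffineConj G F := MarkedPoly.toModuli_eq_iff.1 hG
    exact ⟨h.isStrictlyPreperiodic h1, by rw [h.ramificationIndex_eq hd, h2]⟩
  · rintro ⟨h1, h2⟩
    exact ⟨F, rfl, h1, h2⟩

theorem isStrictlyPreperiodic_one_iff (g : ℂ → ℂ) (k : ℕ) (x : ℂ) :
    IsStrictlyPreperiodic g k 1 x ↔
      g^[k + 1] x = g^[k] x ∧ ∀ l < k, g^[l + 1] x ≠ g^[l] x := by
  refine and_congr_right fun _ => ⟨fun h l hl => h l 1 hl.le le_rfl le_rfl ?_, ?_⟩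
  · simp [hl.ne]
  · intro h l m hl h1 h2 hne
    obtain rfl : m = 1 := by omega
    refine h l (lt_of_le_of_ne hl ?_)
    rintro rfl
    exact hne rfl

theorem MarkedPoly.IsNormalized.ramificationIndex_eq_iff {d : ℕ} (hd : 1 ≤ d) {F : MarkedPoly d}
    (hF : F.IsNormalized) {j : ℕ} (hj : 1 ≤ j) :
    F.ramificationIndex = j ↔ (∀ i, 1 ≤ i → i < j → F.poly.coeff i = 0) ∧ F.poly.coeff j ≠ 0 := by
  have hF0 : F.poly - C (F.poly.eval 0) ≠ 0 := fun h0 => by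
    have h1 := congrArg natDegree (sub_eq_zero.1 h0)
    rw [F.natDegree_eq, natDegree_C] at h1; omega
  have hc : ∀ i, (F.poly - C (F.poly.eval 0)).coeff i = if i = 0 then 0 else F.poly.coeff i := by
    intro i
    rcases i with _ | i
    · simp [coeff_zero_eq_eval_zero]
    · simp
  have hle : ∀ n, n ≤ F.ramificationIndex ↔ ∀ i, 1 ≤ i → i < n → F.poly.coeff i = 0 := by
    intro n
    rw [MarkedPoly.ramificationIndex, hF.2, le_rootMultiplicity_iff hF0, C_0, sub_zero,
      X_pow_dvd_iff]
    refine forall_congr' fun i => ?_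
    rw [hc]
    rcases i with _ | i <;> simp
  constructor
  · rintro rfl
    refine ⟨(hle _).1 le_rfl, fun h => ?_⟩
    have := (hle (F.ramificationIndex + 1)).2 fun i h1 h2 => by
      rcases Nat.lt_succ_iff_lt_or_eq.1 h2 with h3 | rfl
      · exact (hle _).1 le_rfl i h1 h3
      · exact h
    omega
  · rintro ⟨h1, h2⟩
    refine le_antisymm ?_ ((hle j).2 h1)
    by_contra! h
    exact h2 ((hle _).1 le_rfl j hj h)

/-! ### The family of normalized polynomials with prescribed ramification. -/

/-- `X ^ p + ∑ i, a i * X ^ (j + i) + b`. -/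
noncomputable def slicePoly (p j : ℕ) {m : ℕ} (a : Fin m → ℂ) (b : ℂ) : ℂ[X] :=
  X ^ p + ∑ i, C (a i) * X ^ (j + (i : ℕ)) + C b

section

variable {p j m : ℕ} (a : Fin m → ℂ) (b : ℂ)

theorem slicePoly_monic_and_natDegree (hp : 1 ≤ p) (hjm : j + m ≤ p) :
    (slicePoly p j a b).Monic ∧ (slicePoly p j a b).natDegree = p := by
  have hlt : (∑ i, C (a i) * X ^ (j + (i : ℕ)) + C b).degree < (X ^ p : ℂ[X]).degree := by
    rw [degree_X_pow]
    refine (degree_add_le _ _).trans_lt (max_lt ?_ ?_)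
    · refine (degree_sum_le _ _).trans_lt ((Finset.sup_lt_iff (WithBot.bot_lt_coe _)).2 ?_)
      intro i _
      exact (degree_C_mul_X_pow_le _ _).trans_lt (Nat.cast_lt.2 (by omega))
    · exact degree_C_le.trans_lt (by exact_mod_cast hp)
  rw [slicePoly, add_assoc]
  exact ⟨(monic_X_pow p).add_of_left hlt, by
    rw [natDegree_add_eq_left_of_degree_lt hlt, natDegree_X_pow]⟩

theorem coeff_slicePoly (i : ℕ) :
    (slicePoly p j a b).coeff i = (if i = p then 1 else 0) +
      ∑ t : Fin m, (if i = j + (t : ℕ) then a t else 0) + (if i = 0 then b else 0) := by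
  simp [slicePoly, coeff_X_pow, coeff_C]

theorem eval_slicePoly_iterate (l : ℕ) :
    (fun z => (slicePoly p j a b).eval z)^[l] 0 = criticalOrbit p j a b l := by
  induction l with
  | zero => rfl
  | succ l ih =>
    rw [Function.iterate_succ_apply', ih]
    simp [slicePoly, criticalOrbit, eval_finsetSum]

/-- The polynomial `slicePoly` marked at `0`. -/
noncomputable def sliceMarked (hj : 2 ≤ j) (hp : 2 ≤ p) (hjm : j + m ≤ p) (a : Fin m → ℂ) (b : ℂ) :
    MarkedPoly p where
  poly := slicePoly p j a b
  point := 0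
  natDegree_eq := (slicePoly_monic_and_natDegree a b (by omega) hjm).2
  isCritical := by
    rw [← coeff_zero_eq_eval_zero, coeff_derivative, coeff_slicePoly, if_neg (by omega),
      Finset.sum_eq_zero (fun t _ => if_neg (by omega))]
    simp

theorem sliceMarked_isNormalized (hj : 2 ≤ j) (hp : 2 ≤ p) (hjm : j + m ≤ p) :
    (sliceMarked hj hp hjm a b).IsNormalized :=
  ⟨(slicePoly_monic_and_natDegree a b (by omega) hjm).1, rfl⟩

theorem coeff_sliceMarked_add (hj : 2 ≤ j) (hp : 2 ≤ p) (hjm : j + m ≤ p) (t : Fin m) :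
    (sliceMarked hj hp hjm a b).poly.coeff (j + t) = a t := by
  change (slicePoly p j a b).coeff _ = _
  rw [coeff_slicePoly, if_neg (by omega), if_neg (by omega), zero_add, add_zero,
    Finset.sum_eq_single t]
  · rw [if_pos rfl]
  · intro s _ hs
    rw [if_neg fun h => hs (Fin.ext (by omega))]
  · simp

theorem sliceMarked_mem_iff [NeZero m] (hj : 2 ≤ j) (hp : 2 ≤ p) (hjm : j + m ≤ p) (k : ℕ) :
    (sliceMarked hj hp hjm a b).toModuli ∈ preperiodicLocus p k 1 j ↔ (a, b) ∈ slice p j m k := by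
  rw [toModuli_mem_preperiodicLocus (by omega), isStrictlyPreperiodic_one_iff,
    (sliceMarked_isNormalized a b hj hp hjm).ramificationIndex_eq_iff (by omega) (by omega)]
  have h0 := coeff_sliceMarked_add a b hj hp hjm 0
  rw [Fin.val_zero, add_zero] at h0
  have hlow : ∀ i, 1 ≤ i → i < j → (sliceMarked hj hp hjm a b).poly.coeff i = 0 := by
    intro i h1 h2
    change (slicePoly p j a b).coeff _ = _
    rw [coeff_slicePoly, if_neg (by omega), if_neg (by omega),
      Finset.sum_eq_zero (fun t _ => if_neg (by omega))]
    simp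
  rw [h0, and_iff_right hlow]
  change ((fun z => (slicePoly p j a b).eval z)^[k + 1] 0 =
    (fun z => (slicePoly p j a b).eval z)^[k] 0 ∧ ∀ l < k,
    (fun z => (slicePoly p j a b).eval z)^[l + 1] 0 ≠
    (fun z => (slicePoly p j a b).eval z)^[l] 0) ∧ _ ↔ _
  simp only [eval_slicePoly_iterate]
  exact and_comm

/-- Ramification index `j` kills the coefficients in degrees `1, ..., j - 1`, so the remaining ones
are free parameters. -/
theorem exists_sliceMarked_of_mem (hj : 2 ≤ j) (hjp : j < p) {k : ℕ} {x : Moduli p}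
    (hx : x ∈ preperiodicLocus p k 1 j) : ∃ (a : Fin (p - j) → ℂ) (b : ℂ),
      (sliceMarked hj (by omega) (by omega) a b).toModuli = x := by
  obtain ⟨F, hF, rfl⟩ := exists_isNormalized (by omega) x
  rw [toModuli_mem_preperiodicLocus (by omega),
    hF.ramificationIndex_eq_iff (by omega) (by omega)] at hx
  refine ⟨fun t => F.poly.coeff (j + t), F.poly.coeff 0, congrArg _ (MarkedPoly.ext' ?_ hF.2.symm)⟩
  ext i
  change (slicePoly p j _ _).coeff i = _
  rw [coeff_slicePoly]
  have hsum : ∀ t : Fin (p - j), i = j + t →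
      ∑ s : Fin (p - j), (if i = j + (s : ℕ) then F.poly.coeff (j + s) else 0) =
        F.poly.coeff i := by
    rintro t rfl
    rw [Finset.sum_eq_single t]
    · rw [if_pos rfl]
    · intro s _ hs
      rw [if_neg fun h => hs (Fin.ext (by omega))]
    · simp
  have hmon := hF.1.coeff_natDegree
  rw [F.natDegree_eq] at hmon
  rcases lt_trichotomy i p with hi | rfl | hi
  · rw [if_neg hi.ne]
    by_cases hij : i < j
    · rw [Finset.sum_eq_zero (fun t _ => if_neg (by omega))]
      by_cases hi0 : i = 0
      · simp [hi0]
      · simp [hi0, hx.2.1 i (by omega) hij]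
    · rw [hsum ⟨i - j, by omega⟩ (by simp; omega), if_neg (by omega)]
      simp
  · rw [if_pos rfl, Finset.sum_eq_zero (fun t _ => if_neg (by omega)), if_neg (by omega), hmon]
    simp
  · rw [if_neg hi.ne', Finset.sum_eq_zero (fun t _ => if_neg (by omega)), if_neg (by omega),
      coeff_eq_zero_of_natDegree_lt (by rw [F.natDegree_eq]; exact hi)]
    simp

end

/-! ### Regular functions as polynomials in normalized coefficients. -/

theorem eval_aeval {σ τ : Type*} (f : τ → MvPolynomial σ ℂ) (x : σ → ℂ) (Q : MvPolynomial τ ℂ) :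
    MvPolynomial.eval x (MvPolynomial.aeval f Q) =
      MvPolynomial.eval (fun i => MvPolynomial.eval x (f i)) Q := by
  rw [← MvPolynomial.coe_aeval_eq_eval, ← MvPolynomial.coe_aeval_eq_eval, RingHom.coe_coe,
    RingHom.coe_coe, ← AlgHom.comp_apply, MvPolynomial.comp_aeval]

/-- The normal form translated so that the marked point is `0`. -/
noncomputable def Param.centered {d : ℕ} (x : Param d) : ℂ[X] :=
  x.normalForm.comp (X + C x.marked) - C x.marked

section

variable {d : ℕ} (x : Param d)

theorem Param.natDegree_centered (hd : 2 ≤ d) : x.centered.natDegree = d := by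
  have h : (x.normalForm.comp (X + C x.marked)).natDegree = d := by
    rw [natDegree_comp, natDegree_X_add_C, mul_one, x.natDegree_normalForm hd]
  rw [Param.centered, natDegree_sub_C, h]

theorem Param.derivative_centered (hd : 2 ≤ d) : x.centered.derivative =
    C (d : ℂ) * (X * ∏ i, (X - C (x (some i) - x.marked))) := by
  rw [Param.centered, derivative_sub, derivative_C, sub_zero, derivative_comp,
    x.derivative_normalForm hd]
  have h : (x.critPts.map (fun t => X - C t)).prod =
      (X - C x.marked) * ∏ i, (X - C (x (some i))) := by
    rw [Param.critPts, Multiset.map_cons, Multiset.prod_cons, Multiset.map_map]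
    rfl
  rw [h]
  simp only [derivative_X_add_C, one_mul, mul_comp, C_comp, sub_comp, X_comp, prod_comp]
  congr 2
  · ring
  · refine Finset.prod_congr rfl fun i _ => ?_
    rw [C_sub]; ring

theorem Param.coeff_zero_centered : x.centered.coeff 0 = x none - x.marked := by
  rw [coeff_zero_eq_eval_zero, Param.centered, Param.normalForm]
  simp

theorem Param.centered_monic (hd : 2 ≤ d) : x.centered.Monic := by
  have h1 := congrArg (fun f => f.coeff (d - 1)) (x.derivative_centered hd)
  have hm : (X * ∏ i, (X - C (x (some i) - x.marked))).Monic :=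
    monic_X.mul (monic_prod_of_monic _ _ fun i _ => monic_X_sub_C _)
  have hdeg : (X * ∏ i, (X - C (x (some i) - x.marked))).natDegree = d - 1 := by
    rw [monic_X.natDegree_mul (monic_prod_of_monic _ _ fun i _ => monic_X_sub_C _),
      natDegree_prod_of_monic _ _ fun i _ => monic_X_sub_C _]
    simp only [natDegree_X, natDegree_X_sub_C, Finset.sum_const, Finset.card_univ, Fintype.card_fin,
      smul_eq_mul, mul_one]
    omega
  have h2 := hm.coeff_natDegree
  rw [hdeg] at h2
  have hd0 : (d : ℂ) ≠ 0 := by exact_mod_cast (by omega : d ≠ 0)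
  simp only [coeff_derivative, coeff_C_mul] at h1
  rw [h2, mul_one, Nat.sub_add_cancel (by omega : 1 ≤ d), Nat.cast_sub (by omega), Nat.cast_one,
    sub_add_cancel] at h1
  rw [Monic, leadingCoeff, x.natDegree_centered hd]
  exact mul_right_cancel₀ hd0 (by rw [h1, one_mul])

/-- The translated normal form marked at `0`. -/
noncomputable def Param.centeredMarked (hd : 2 ≤ d) : MarkedPoly d where
  poly := x.centered
  point := 0
  natDegree_eq := x.natDegree_centered hd
  isCritical := by simp [x.derivative_centered hd]

theorem Param.centeredMarked_isNormalized (hd : 2 ≤ d) : (x.centeredMarked hd).IsNormalized :=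
  ⟨x.centered_monic hd, rfl⟩

theorem Param.toModuli_centeredMarked [d.AtLeastTwo] :
    (x.centeredMarked Nat.AtLeastTwo.prop).toModuli = x.toModuli := by
  refine MarkedPoly.toModuli_eq_iff.2 ⟨1, x.marked, one_ne_zero, fun z => ?_, ?_⟩
  · change x.normalForm.eval _ = 1 * x.centered.eval z + _
    simp [Param.centered]
  · change x.marked = 1 * 0 + x.marked
    simp

end

/-- The derivative is an explicit product over the relative critical points; positive-degree
coefficients come from it by dividing by `i + 1`. -/
theorem Param.exists_eval_eq_coeff_centered {d : ℕ} (hd : 2 ≤ d) (i : ℕ) :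
    ∃ P : MvPolynomial (Option (Fin (d - 2))) ℂ, ∀ x : Param d,
      x.centered.coeff i = MvPolynomial.eval x P := by
  let c : MvPolynomial (Option (Fin (d - 2))) ℂ := -∑ i, MvPolynomial.X (some i)
  have hc : ∀ x : Param d, MvPolynomial.eval x c = x.marked := fun x => by simp [c, Param.marked]
  rcases i with _ | i
  · exact ⟨MvPolynomial.X none - c, fun x => by rw [x.coeff_zero_centered]; simp [hc]⟩
  · let D : (MvPolynomial (Option (Fin (d - 2))) ℂ)[X] :=
      C (MvPolynomial.C (d : ℂ)) * (X * ∏ i, (X - C (MvPolynomial.X (some i) - c)))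
    have hD : ∀ x : Param d, x.centered.derivative = D.map (MvPolynomial.eval x) := fun x => by
      rw [x.derivative_centered hd]
      simp [D, Polynomial.map_prod, hc]
    refine ⟨MvPolynomial.C (((i : ℂ) + 1)⁻¹) * D.coeff i, fun x => ?_⟩
    have h := coeff_derivative x.centered i
    rw [hD, coeff_map] at h
    have h0 : (i : ℂ) + 1 ≠ 0 := Nat.cast_add_one_ne_zero i
    rw [map_mul, h, MvPolynomial.eval_C]
    field_simp

/-- A polynomial in the coefficients of normalized polynomials which is invariant under conjugation
descends to a regular function. -/
theorem exists_regularFunction {d : ℕ} [d.AtLeastTwo] (Q : MvPolynomial ℕ ℂ)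
    (hQ : ∀ F G : MarkedPoly d, F.IsNormalized → G.IsNormalized → AffineConj F G →
      MvPolynomial.eval G.poly.coeff Q = MvPolynomial.eval F.poly.coeff Q) :
    ∃ φ ∈ regularFunctions d, ∀ F : MarkedPoly d, F.IsNormalized →
      φ F.toModuli = MvPolynomial.eval F.poly.coeff Q := by
  have hd : 2 ≤ d := Nat.AtLeastTwo.prop
  choose F hF hFm using exists_isNormalized hd
  have key : ∀ G : MarkedPoly d, G.IsNormalized →
      MvPolynomial.eval (F G.toModuli).poly.coeff Q = MvPolynomial.eval G.poly.coeff Q :=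
    fun G hG => hQ _ _ hG (hF _) (MarkedPoly.toModuli_eq_iff.1 (hFm _).symm)
  refine ⟨fun m => MvPolynomial.eval (F m).poly.coeff Q, ?_, key⟩
  choose P hP using Param.exists_eval_eq_coeff_centered hd
  refine ⟨MvPolynomial.aeval P Q, fun x => ?_⟩
  rw [← x.toModuli_centeredMarked, eval_aeval]
  refine (key _ (x.centeredMarked_isNormalized hd)).trans ?_
  congr 2
  funext i
  exact hP i x

/-- The fundamental theorem on symmetric polynomials, applied to each coefficient of `P` as a
polynomial in `b`. -/
theorem exists_eval_esymm {n : ℕ} (P : MvPolynomial (Option (Fin n)) ℂ)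
    (hP : ∀ (σ : Equiv.Perm (Fin n)) (γ : Fin n → ℂ) (b : ℂ),
      MvPolynomial.eval (fun o => Option.elim o b (γ ∘ σ)) P =
        MvPolynomial.eval (fun o => Option.elim o b γ) P) :
    ∃ Q : MvPolynomial (Option (Fin n)) ℂ, ∀ (γ : Fin n → ℂ) (b : ℂ),
      MvPolynomial.eval (fun o => Option.elim o b γ) P = MvPolynomial.eval (fun o =>
        Option.elim o b fun i : Fin n => MvPolynomial.eval γ (MvPolynomial.esymm (Fin n) ℂ (i + 1)))
        Q := by
  set p := MvPolynomial.optionEquivLeft ℂ (Fin n) P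
  have hsymm : ∀ i, (p.coeff i).IsSymmetric := by
    intro i σ
    refine MvPolynomial.funext fun γ => ?_
    rw [MvPolynomial.eval_rename, ← coeff_map, ← coeff_map]
    congr 1
    refine Polynomial.funext fun b => ?_
    rw [← MvPolynomial.optionEquivLeft_elim_eval, ← MvPolynomial.optionEquivLeft_elim_eval, hP]
  have hq : ∀ i, ∃ q : MvPolynomial (Fin n) ℂ,
      MvPolynomial.aeval (fun t : Fin n => MvPolynomial.esymm (Fin n) ℂ (t + 1)) q = p.coeff i := by
    intro i
    obtain ⟨q, hq⟩ := MvPolynomial.esymmAlgHom_surjective (σ := Fin n) (n := n) ℂ (by simp)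
      ⟨p.coeff i, hsymm i⟩
    refine ⟨q, ?_⟩
    rw [← MvPolynomial.esymmAlgHom_apply, hq]
  choose q hq using hq
  refine ⟨∑ i ∈ Finset.range (p.natDegree + 1),
    MvPolynomial.rename some (q i) * MvPolynomial.X none ^ i, fun γ b => ?_⟩
  rw [MvPolynomial.optionEquivLeft_elim_eval,
    eval_eq_sum_range' (Nat.lt_succ_of_le (natDegree_map_le (f := MvPolynomial.eval γ) (p := p))),
    map_sum]
  refine Finset.sum_congr rfl fun i _ => ?_
  rw [map_mul, map_pow, MvPolynomial.eval_X, MvPolynomial.eval_rename, coeff_map, ← hq, eval_aeval]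
  rfl

theorem MarkedPoly.IsNormalized.exists_derivative_eq {d : ℕ} (hd : 2 ≤ d) {F : MarkedPoly d}
    (hF : F.IsNormalized) : ∃ γ : Fin (d - 2) → ℂ,
      F.poly.derivative = C (d : ℂ) * (X * ∏ i, (X - C (γ i))) := by
  have hd0 : (d : ℂ) ≠ 0 := by exact_mod_cast (by omega : d ≠ 0)
  have hdeg : F.poly.derivative.natDegree = d - 1 := by
    rw [natDegree_derivative, F.natDegree_eq]
  have hlc : F.poly.derivative.leadingCoeff = d := by
    have := hF.1.coeff_natDegree
    rw [F.natDegree_eq] at this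
    rw [leadingCoeff, hdeg, coeff_derivative, Nat.sub_add_cancel (by omega), this, one_mul,
      Nat.cast_sub (by omega), Nat.cast_one, sub_add_cancel]
  have hne : F.poly.derivative ≠ 0 := fun h => hd0 (by rw [← hlc, h, leadingCoeff_zero])
  have hs := IsAlgClosed.splits F.poly.derivative
  have hmem : (0 : ℂ) ∈ F.poly.derivative.roots := by
    rw [mem_roots hne, IsRoot]
    have := F.isCritical
    rwa [hF.2] at this
  obtain ⟨s, hr⟩ := Multiset.exists_cons_of_mem hmem
  have hcard : s.card = d - 2 := by
    have := hs.natDegree_eq_card_roots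
    rw [hr, Multiset.card_cons, hdeg] at this
    omega
  obtain ⟨γ, hγ⟩ : ∃ γ : Fin (d - 2) → ℂ, Finset.univ.val.map γ = s := by
    have hl : s.toList.length = d - 2 := by rw [Multiset.length_toList, hcard]
    refine ⟨fun i => s.toList.get (i.cast hl.symm), ?_⟩
    rw [Fin.univ_val_map]
    conv_rhs => rw [← s.coe_toList]
    congr 1
    exact List.ext_get (by simp [hl]) (by simp)
  refine ⟨γ, ?_⟩
  rw [hs.eq_prod_roots, hlc, hr, Multiset.map_cons, Multiset.prod_cons, C_0, sub_zero, ← hγ,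
    Multiset.map_map]
  rfl

theorem eq_of_derivative_eq {f g : ℂ[X]} (h : f.derivative = g.derivative)
    (h0 : f.coeff 0 = g.coeff 0) : f = g := by
  ext i
  rcases i with _ | i
  · exact h0
  · have := congrArg (fun q => q.coeff i) h
    simp only [coeff_derivative] at this
    exact mul_right_cancel₀ (Nat.cast_add_one_ne_zero i) this

/-- The parameter whose critical points relative to the marked one are `γ`, and whose critical value
relative to the marked point is `b`. -/
noncomputable def paramOfRelative (d : ℕ) (γ : Fin (d - 2) → ℂ) (b : ℂ) : Param d :=
  fun o => Option.elim o b γ + -((d : ℂ) - 1)⁻¹ * ∑ i, γ i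

/-- The shift `t` is forced by the critical points `t` and `γ i + t` having sum zero: `(d - 1) t + ∑
γ i = 0`. -/
theorem marked_paramOfRelative {d : ℕ} (hd : 2 ≤ d) (γ : Fin (d - 2) → ℂ) (b : ℂ) :
    (paramOfRelative d γ b).marked = -((d : ℂ) - 1)⁻¹ * ∑ i, γ i := by
  have h : (d : ℂ) - 1 ≠ 0 := by
    rw [sub_ne_zero]; exact_mod_cast (by omega : d ≠ 1)
  simp only [Param.marked, paramOfRelative, Option.elim_some, Finset.sum_add_distrib,
    Finset.sum_const, Finset.card_univ, Fintype.card_fin, nsmul_eq_mul]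
  rw [Nat.cast_sub hd]
  field_simp
  push_cast
  ring

theorem toModuli_paramOfRelative_comp {d : ℕ} [d.AtLeastTwo] (γ : Fin (d - 2) → ℂ) (b : ℂ)
    (σ : Equiv.Perm (Fin (d - 2))) :
    (paramOfRelative d (γ ∘ σ) b).toModuli = (paramOfRelative d γ b).toModuli := by
  have hd : 2 ≤ d := Nat.AtLeastTwo.prop
  have hsum : ∑ i, (γ ∘ σ) i = ∑ i, γ i := Equiv.sum_comp σ γ
  rw [← Param.toModuli_centeredMarked, ← Param.toModuli_centeredMarked]
  refine congrArg _ (MarkedPoly.ext' (eq_of_derivative_eq ?_ ?_) rfl)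
  · change (Param.centered _).derivative = (Param.centered _).derivative
    rw [Param.derivative_centered _ hd, Param.derivative_centered _ hd]
    simp only [marked_paramOfRelative hd, hsum, paramOfRelative, Option.elim_some,
      add_sub_cancel_right]
    congr 2
    exact Equiv.prod_comp σ fun i => X - C (γ i)
  · change (Param.centered _).coeff 0 = (Param.centered _).coeff 0
    rw [Param.coeff_zero_centered, Param.coeff_zero_centered]
    simp only [marked_paramOfRelative hd, hsum, paramOfRelative, Option.elim_none]

/-- Regular functions are polynomials in the coefficients of normalized polynomials. -/
theorem exists_eval_coeff {d : ℕ} [d.AtLeastTwo] {φ : Moduli d → ℂ} (hφ : φ ∈ regularFunctions d) :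
    ∃ Q : MvPolynomial ℕ ℂ, ∀ F : MarkedPoly d, F.IsNormalized →
      φ F.toModuli = MvPolynomial.eval F.poly.coeff Q := by
  have hd : 2 ≤ d := Nat.AtLeastTwo.prop
  have hd0 : (d : ℂ) ≠ 0 := by exact_mod_cast (by omega : d ≠ 0)
  obtain ⟨P, hP⟩ := hφ
  let P' : MvPolynomial (Option (Fin (d - 2))) ℂ := MvPolynomial.aeval (fun o =>
    MvPolynomial.X o + MvPolynomial.C (-((d : ℂ) - 1)⁻¹) * ∑ i, MvPolynomial.X (some i)) P
  have hP' : ∀ γ b, MvPolynomial.eval (fun o => Option.elim o b γ) P' =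
      φ (paramOfRelative d γ b).toModuli := by
    intro γ b
    rw [hP, eval_aeval]
    congr 2
    funext o
    simp [paramOfRelative]
  obtain ⟨Q, hQ⟩ := exists_eval_esymm P' fun σ γ b => by
    rw [hP', hP', toModuli_paramOfRelative_comp]
  -- With `n = d - 2 - (i + 1)`, comparing coefficients of `X ^ (n + 1)` in `f' = d X ∏ (X - γ)`
  -- gives `(n + 2) f_{n+2} = d (-1)^(i+1) e_{i+1}(γ)`; this is solved for `e_{i+1}`.
  refine ⟨MvPolynomial.aeval (fun o => Option.elim o (MvPolynomial.X 0) fun i : Fin (d - 2) =>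
    MvPolynomial.C ((-1) ^ ((i : ℕ) + 1) * (((d - 2 - (i + 1) + 1 : ℕ) : ℂ) + 1) / d) *
      MvPolynomial.X (d - 2 - (i + 1) + 1 + 1)) Q, fun F hF => ?_⟩
  obtain ⟨γ, hγ⟩ := hF.exists_derivative_eq hd
  have hFx : F.toModuli = (paramOfRelative d γ (F.poly.coeff 0)).toModuli := by
    rw [← Param.toModuli_centeredMarked]
    refine congrArg _ (MarkedPoly.ext' (eq_of_derivative_eq ?_ ?_) hF.2)
    · change _ = (Param.centered _).derivative
      rw [Param.derivative_centered _ hd, hγ]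
      simp [marked_paramOfRelative hd, paramOfRelative]
    · change _ = (Param.centered _).coeff 0
      rw [Param.coeff_zero_centered, marked_paramOfRelative hd]
      simp [paramOfRelative]
  rw [hFx, ← hP', hQ, eval_aeval]
  congr 2
  funext o
  rcases o with _ | i
  · simp
  · simp only [Option.elim_some, map_mul, MvPolynomial.eval_X, MvPolynomial.eval_C]
    have h1 : MvPolynomial.eval γ (MvPolynomial.esymm (Fin (d - 2)) ℂ (i + 1)) =
        (Finset.univ.val.map γ).esymm (i + 1) := by
      rw [← MvPolynomial.coe_aeval_eq_eval, RingHom.coe_coe,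
        MvPolynomial.aeval_esymm_eq_multiset_esymm]
    have hcard : (Finset.univ.val.map γ).card = d - 2 := by simp
    have h2 := Multiset.prod_X_sub_C_coeff (Finset.univ.val.map γ) (k := d - 2 - (i + 1))
      (by rw [hcard]; omega)
    have h3 := congrArg (fun f => f.coeff (d - 2 - (i + 1) + 1)) hγ
    simp only [coeff_derivative, coeff_C_mul, coeff_X_mul] at h3
    rw [hcard, show d - 2 - (d - 2 - (i + 1)) = (i : ℕ) + 1 by omega, Multiset.map_map] at h2
    change (∏ i, (X - C (γ i))).coeff _ = _ at h2
    rw [h2] at h3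
    have h4 : ((-1 : ℂ) ^ ((i : ℕ) + 1)) * (-1) ^ ((i : ℕ) + 1) = 1 := by
      rw [← mul_pow]; simp
    rw [h1]
    rw [mul_div_assoc, mul_assoc, div_mul_eq_mul_div, mul_comm (_ + 1 : ℂ), h3,
      mul_div_cancel_left₀ _ hd0, ← mul_assoc, h4, one_mul]

/-! ### Zariski topology, irreducibility and dimension via regular functions. -/

section Topology

variable {d : ℕ} [d.AtLeastTwo]

theorem isClosed_iff_zeroLocus {Z : Set (Moduli d)} :
    IsClosed Z ↔ ∃ I : Set (Moduli d → ℂ), I ⊆ regularFunctions d ∧ Z = zeroLocus I := by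
  rw [← isOpen_compl_iff]
  change Zᶜᶜ ∈ {Z | ∃ I : Set (Moduli d → ℂ), I ⊆ regularFunctions d ∧ Z = zeroLocus I} ↔ _
  rw [compl_compl]
  rfl

theorem isClosed_setOf_eq_zero {φ : Moduli d → ℂ} (hφ : φ ∈ regularFunctions d) :
    IsClosed {x | φ x = 0} :=
  isClosed_iff_zeroLocus.2 ⟨{φ}, by simpa using hφ, by simp [zeroLocus]⟩

variable {S : Set (Moduli d)}

theorem exists_regular_of_notMem {Z : Set S} (hZ : IsClosed Z) {s : S} (hs : s ∉ Z) :
    ∃ φ ∈ regularFunctions d, (∀ z ∈ Z, φ (z : Moduli d) = 0) ∧ φ s ≠ 0 := by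
  obtain ⟨W, hW, rfl⟩ := isClosed_induced_iff.1 hZ
  obtain ⟨I, hI, rfl⟩ := isClosed_iff_zeroLocus.1 hW
  simp only [Set.mem_preimage, zeroLocus, Set.mem_ofPred_eq, not_forall] at hs
  obtain ⟨φ, hφ, h⟩ := hs
  exact ⟨φ, hI hφ, fun z hz => hz φ hφ, h⟩

theorem isIrreducible_of_regular {T : Set S} (hne : T.Nonempty)
    (h : ∀ φ ∈ regularFunctions d, ∀ ψ ∈ regularFunctions d,
      (∀ t ∈ T, φ (t : Moduli d) * ψ t = 0) →
        (∀ t ∈ T, φ (t : Moduli d) = 0) ∨ ∀ t ∈ T, ψ (t : Moduli d) = 0) : IsIrreducible T := by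
  refine ⟨hne, isPreirreducible_iff_isClosed_union_isClosed.2 fun Z W hZ hW hT => ?_⟩
  by_contra! hc
  obtain ⟨⟨t, ht, htZ⟩, u, hu, huW⟩ := Set.not_subset.1 hc.1, Set.not_subset.1 hc.2
  obtain ⟨φ, hφ, hφZ, hφt⟩ := exists_regular_of_notMem hZ htZ
  obtain ⟨ψ, hψ, hψW, hψu⟩ := exists_regular_of_notMem hW huW
  rcases h φ hφ ψ hψ (fun s hs => by
    rcases hT hs with h1 | h1
    · rw [hφZ s h1, zero_mul]
    · rw [hψW s h1, mul_zero]) with h1 | h1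
  · exact hφt (h1 t ht)
  · exact hψu (h1 u hu)

/-- The prime ideal of regular functions vanishing on an irreducible closed subset. -/
def vanishingPrime (Z : TopologicalSpace.IrreducibleCloseds S) :
    PrimeSpectrum (regularFunctions d) where
  asIdeal :=
    { carrier := {φ | ∀ z ∈ Z, (φ : Moduli d → ℂ) (z : Moduli d) = 0}
      add_mem' := fun {φ ψ} h1 h2 z hz => by
        change (φ : Moduli d → ℂ) z + (ψ : Moduli d → ℂ) z = 0
        rw [h1 z hz, h2 z hz, add_zero]
      zero_mem' := fun _ _ => rfl
      smul_mem' := fun φ ψ h z hz => by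
        change (φ : Moduli d → ℂ) z * (ψ : Moduli d → ℂ) z = 0
        rw [h z hz, mul_zero] }
  isPrime := by
    refine ⟨fun h => ?_, fun {φ ψ} h => ?_⟩
    · obtain ⟨z, hz⟩ := Z.isIrreducible'.1
      exact one_ne_zero (((Ideal.eq_top_iff_one _).1 h) z hz)
    · have hc : ∀ φ : regularFunctions d, IsClosed {s : S | (φ : Moduli d → ℂ) s = 0} := fun φ =>
        (isClosed_setOf_eq_zero φ.2).preimage continuous_subtype_val
      exact isPreirreducible_iff_isClosed_union_isClosed.1 Z.isIrreducible'.2 _ _ (hc φ) (hc ψ)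
        fun z hz => mul_eq_zero.1 (h z hz)

/-- If every regular function is integral over `A` modulo functions vanishing on `S`, then the
dimension of `S` is at most that of `A`. -/
theorem topologicalKrullDim_le_of_integral {A : Type*} [CommRing A] (f : A →+* regularFunctions d)
    (hf : ∀ φ : regularFunctions d, ∃ q : A[X], q.Monic ∧
      ∀ s ∈ S, ((q.eval₂ f φ : regularFunctions d) : Moduli d → ℂ) s = 0) :
    topologicalKrullDim S ≤ ringKrullDim A := by
  -- Vanishing ideals reverse inclusion, hence the order dual, which has the same Krull dimension.
  let F : (TopologicalSpace.IrreducibleCloseds S)ᵒᵈ → PrimeSpectrum A := fun Z =>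
    PrimeSpectrum.comap f (vanishingPrime (OrderDual.ofDual Z))
  have hF : StrictMono F := by
    intro W Z hWZ
    obtain ⟨hle, s, hs, hsZ⟩ := SetLike.lt_iff_le_and_exists.1 (OrderDual.ofDual_lt_ofDual.2 hWZ)
    obtain ⟨φ, hφ, hφZ, hφs⟩ := exists_regular_of_notMem (OrderDual.ofDual Z).isClosed' hsZ
    obtain ⟨q, hq, hq0⟩ := hf ⟨φ, hφ⟩
    -- Incomparability: `φ` lies in the larger prime only and is a root of a monic polynomial modulo
    -- the smaller, so the contractions to `A` stay distinct.
    exact Ideal.comap_lt_comap_of_root_mem_sdiff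
      (I := (vanishingPrime (OrderDual.ofDual W)).asIdeal)
      (J := (vanishingPrime (OrderDual.ofDual Z)).asIdeal) (fun ψ hψ z hz => hψ z (hle hz))
      (r := ⟨φ, hφ⟩) ⟨fun z hz => hφZ z hz, fun h => hφs (h s hs)⟩
      (map_monic_ne_zero hq) fun z _ => hq0 z z.2
  rw [topologicalKrullDim, ← Order.krullDim_orderDual]
  exact Order.krullDim_le_of_strictMono F hF

end Topology

/-! ### Invariant functions cutting out the locus. -/

/-- The iterates of `0` as polynomials in the coefficients of a polynomial of degree `d`. -/
noncomputable def orbitPoly (d : ℕ) : ℕ → MvPolynomial ℕ ℂ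
  | 0 => 0
  | l + 1 => ∑ i ∈ Finset.range (d + 1), MvPolynomial.X i * orbitPoly d l ^ i

theorem MarkedPoly.IsNormalized.eval_orbitPoly {d : ℕ} {F : MarkedPoly d} (hF : F.IsNormalized)
    (l : ℕ) : MvPolynomial.eval F.poly.coeff (orbitPoly d l) =
      (fun z => F.poly.eval z)^[l] F.point := by
  induction l with
  | zero => simp [orbitPoly, hF.2]
  | succ l ih =>
    rw [Function.iterate_succ_apply', eval_eq_sum_range, F.natDegree_eq, ← ih]
    simp [orbitPoly]

section

variable {d : ℕ} [d.AtLeastTwo]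

/-- Conjugation multiplies the coefficient by a power of a `(d - 1)`-th root of unity, which the
exponent `d - 1` removes. -/
theorem exists_regular_coeff_pow (i : ℕ) : ∃ φ ∈ regularFunctions d, ∀ F : MarkedPoly d,
    F.IsNormalized → φ F.toModuli = F.poly.coeff i ^ (d - 1) := by
  obtain ⟨φ, hφ, h⟩ := exists_regularFunction (d := d) (MvPolynomial.X i ^ (d - 1))
    fun F G hF hG hFG => by
      obtain ⟨ζ, hζ, -, hc⟩ := hF.exists_of_affineConj Nat.AtLeastTwo.prop hG hFG
      have := congrArg (· ^ (d - 1)) (hc i)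
      simp only [mul_pow, hζ, one_mul, ← pow_mul] at this
      rw [mul_comm i, pow_mul, hζ, one_pow, mul_one] at this
      simpa using this
  exact ⟨φ, hφ, fun F hF => by rw [h F hF]; simp⟩

theorem exists_regular_iterate_sub_pow (l : ℕ) : ∃ φ ∈ regularFunctions d, ∀ F : MarkedPoly d,
    F.IsNormalized → φ F.toModuli = ((fun z => F.poly.eval z)^[l + 1] F.point -
      (fun z => F.poly.eval z)^[l] F.point) ^ (d - 1) := by
  obtain ⟨φ, hφ, h⟩ := exists_regularFunction (d := d)
    ((orbitPoly d (l + 1) - orbitPoly d l) ^ (d - 1)) fun F G hF hG hFG => by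
      obtain ⟨ζ, hζ, he, -⟩ := hF.exists_of_affineConj Nat.AtLeastTwo.prop hG hFG
      have hit : ∀ l, (fun z => G.poly.eval z)^[l] G.point =
          ζ * (fun z => F.poly.eval z)^[l] F.point := by
        intro l
        induction l with
        | zero => simp [hF.2, hG.2]
        | succ l ih => rw [Function.iterate_succ_apply', Function.iterate_succ_apply', ih, he]
      rw [map_pow, map_pow, map_sub, map_sub, hF.eval_orbitPoly, hF.eval_orbitPoly,
        hG.eval_orbitPoly, hG.eval_orbitPoly, hit, hit, ← mul_sub, mul_pow, hζ, one_mul]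
  exact ⟨φ, hφ, fun F hF => by
    rw [h F hF, map_pow, map_sub, hF.eval_orbitPoly, hF.eval_orbitPoly]⟩

theorem isLocallyClosed_preperiodicLocus {k j : ℕ} (hj : 1 ≤ j) :
    IsLocallyClosed (preperiodicLocus d k 1 j) := by
  have hd : 2 ≤ d := Nat.AtLeastTwo.prop
  choose ξ hξ hξe using exists_regular_coeff_pow (d := d)
  choose η hη hηe using exists_regular_iterate_sub_pow (d := d)
  have he : preperiodicLocus d k 1 j =
      ({x | η k x = 0} ∩ ⋂ i ∈ Finset.Ico 1 j, {x | ξ i x = 0}) ∩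
      ({x | ξ j x = 0}ᶜ ∩ ⋂ l ∈ Finset.range k, {x | η l x = 0}ᶜ) := by
    ext x
    obtain ⟨F, hF, rfl⟩ := exists_isNormalized hd x
    have h0 : d - 1 ≠ 0 := by omega
    rw [toModuli_mem_preperiodicLocus (by omega), isStrictlyPreperiodic_one_iff,
      hF.ramificationIndex_eq_iff (by omega) hj]
    simp only [Set.mem_inter_iff, Set.mem_iInter, Set.mem_compl_iff, Set.mem_ofPred_eq,
      hξe _ F hF, hηe _ F hF, pow_eq_zero_iff h0, sub_eq_zero, Finset.mem_Ico, Finset.mem_range,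
      and_imp]
    tauto
  rw [he]
  refine IsLocallyClosed.inter (IsClosed.isLocallyClosed ?_) (IsOpen.isLocallyClosed ?_)
  · exact (isClosed_setOf_eq_zero (hη k)).inter
      (isClosed_biInter fun i _ => isClosed_setOf_eq_zero (hξ i))
  · exact (isClosed_setOf_eq_zero (hξ j)).isOpen_compl.inter
      (isOpen_biInter_finset fun l _ => (isClosed_setOf_eq_zero (hη l)).isOpen_compl)

end

/-! ### Slices of the locus: dimension and irreducibility. -/

section Slice

variable {p j m : ℕ} [p.AtLeastTwo]

theorem evalAt_aeval {σ τ : Type*} (a : σ → ℂ) (b : ℂ) (c : τ → (MvPolynomial σ ℂ)[X])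
    (Q : MvPolynomial τ ℂ) :
    evalAt a b (MvPolynomial.aeval c Q) = MvPolynomial.eval (fun i => evalAt a b (c i)) Q := by
  have : (evalAt a b).comp (algebraMap ℂ (MvPolynomial σ ℂ)[X]) = RingHom.id ℂ := by
    ext z
    change evalAt a b (C (MvPolynomial.C z)) = z
    simp
  rw [MvPolynomial.map_aeval, this]
  rfl

theorem exists_evalAt_eq (hj : 2 ≤ j) (hp : 2 ≤ p) (hjm : j + m ≤ p) {φ : Moduli p → ℂ}
    (hφ : φ ∈ regularFunctions p) : ∃ q : (MvPolynomial (Fin m) ℂ)[X], ∀ a b,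
      φ (sliceMarked hj hp hjm a b).toModuli = evalAt a b q := by
  obtain ⟨Q, hQ⟩ := exists_eval_coeff hφ
  refine ⟨MvPolynomial.aeval (fun i : ℕ => (if i = p then 1 else 0) +
    ∑ t : Fin m, (if i = j + (t : ℕ) then genericCoeff m t else 0) + (if i = 0 then X else 0)) Q,
    fun a b => ?_⟩
  rw [hQ _ (sliceMarked_isNormalized a b hj hp hjm), evalAt_aeval]
  congr 2
  funext i
  change (slicePoly p j a b).coeff i = _
  rw [coeff_slicePoly]
  simp only [map_add, map_sum, apply_ite (evalAt a b), map_one, map_zero, evalAt_X, genericCoeff,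
    evalAt_C, MvPolynomial.eval_X]

end Slice

section Slice

variable {p j m k : ℕ}

/-- The classes in the `(k, 1)`-preperiodic locus represented by
`X ^ p + ∑ i, a i * X ^ (j + i) + b` with `i ≤ m`. -/
def sliceImage (p j k m : ℕ) : Set (preperiodicLocus p k 1 j) :=
  {s | ∃ (hj : 2 ≤ j) (hp : 2 ≤ p) (hjm : j + (m + 1) ≤ p) (a : Fin (m + 1) → ℂ) (b : ℂ),
    (sliceMarked hj hp hjm a b).toModuli = s}

theorem sliceImage_mono (hjm : j + (m + 2) ≤ p) :
    sliceImage p j k m ⊆ sliceImage p j k (m + 1) := by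
  rintro ⟨_, hs⟩ ⟨hj, hp, -, a, b, rfl⟩
  refine ⟨hj, hp, hjm, Fin.snoc a 0, b, congrArg _ (MarkedPoly.ext' ?_ rfl)⟩
  change slicePoly p j _ b = slicePoly p j a b
  rw [slicePoly, slicePoly, Fin.sum_univ_castSucc]
  simp

variable [Fact p.Prime]

/-- Each `a t` is a root of `T ^ (p - 1) - a t ^ (p - 1)`, and `b` is a root of the monic slice
equation over the ring of the `a t`; transitivity of integrality does the rest. -/
theorem isIntegral_sliceCoordinates {B : Type*} [CommRing B] [NeZero m] (hj : 2 ≤ j)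
    (hjp : j < p) (hjm : j + m ≤ p) (Ψ : (MvPolynomial (Fin m) ℂ)[X] →+* B)
    (hΨ : Ψ (sliceEquation p j m k) = 0) (g : MvPolynomial (Fin m) ℂ →+* B)
    (hgC : ∀ z, g (MvPolynomial.C z) = Ψ (C (MvPolynomial.C z)))
    (hgX : ∀ t, g (MvPolynomial.X t) = Ψ (C (MvPolynomial.X t)) ^ (p - 1))
    (q : (MvPolynomial (Fin m) ℂ)[X]) : g.IsIntegralElem (Ψ q) := by
  have hp := (Fact.out : p.Prime).two_le
  let _ : Algebra (MvPolynomial (Fin m) ℂ) B := g.toAlgebra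
  change IsIntegral (MvPolynomial (Fin m) ℂ) (Ψ q)
  have hC : ∀ c, IsIntegral (MvPolynomial (Fin m) ℂ) (Ψ (C c)) := by
    intro c
    induction c using MvPolynomial.induction_on with
    | C z => rw [← hgC]; exact isIntegral_algebraMap
    | add c c' h h' => rw [C_add, map_add]; exact h.add h'
    | mul_X c t h =>
      rw [C_mul, map_mul]
      refine h.mul (IsIntegral.of_pow (n := p - 1) (by omega) ?_)
      rw [← hgX]; exact isIntegral_algebraMap
  have hX : IsIntegral (MvPolynomial (Fin m) ℂ) (Ψ X) := by
    have hm := sliceEquation_monic (m := m) hp (by omega) hjp.le hjm k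
    have hd := sliceEquation_natDegree_pos (m := m) hp (by omega) hjp hjm k
    rcases subsingleton_or_nontrivial B with hB | hB
    · rw [Subsingleton.elim (Ψ X) 0]; exact isIntegral_zero
    refine IsIntegral.of_aeval_monic_of_isIntegral_coeff (hm.map (Ψ.comp C)) ?_ ?_ ?_
    · rw [hm.natDegree_map]; omega
    · rw [eval_map, ← hom_eval₂, eval₂_C_X, hΨ]; exact isIntegral_zero
    · intro i
      rw [coeff_map]; exact hC _
  induction q using Polynomial.induction_on' with
  | add q q' h h' => rw [map_add]; exact h.add h'
  | monomial n c =>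
    rw [← C_mul_X_pow_eq_monomial, map_mul, map_pow]
    exact (hC c).mul (hX.pow n)

theorem topologicalKrullDim_preperiodicLocus_le (hj : 2 ≤ j) (hjp : j < p) :
    topologicalKrullDim (preperiodicLocus p k 1 j) ≤ ((p - j : ℕ) : WithBot ℕ∞) := by
  have hp := (Fact.out : p.Prime).two_le
  have hjm : j + (p - j) ≤ p := by omega
  have : NeZero (p - j) := ⟨by omega⟩
  choose ξ hξ hξe using exists_regular_coeff_pow (d := p)
  let f : MvPolynomial (Fin (p - j)) ℂ →+* regularFunctions p :=
    (MvPolynomial.aeval fun t : Fin (p - j) =>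
      (⟨ξ (j + t), hξ _⟩ : regularFunctions p)).toRingHom
  have hdim : ringKrullDim (MvPolynomial (Fin (p - j)) ℂ) = ((p - j : ℕ) : WithBot ℕ∞) := by
    rw [MvPolynomial.ringKrullDim_of_isNoetherianRing, ringKrullDim_eq_zero_of_field]
    simp
  rw [← hdim]
  refine topologicalKrullDim_le_of_integral f fun φ => ?_
  -- The comparison takes place in the ring of all functions on the slice: since `π` hits every
  -- point of the locus, a relation there vanishes on the locus.
  let π : slice p j (p - j) k → Moduli p := fun y =>
    (sliceMarked hj hp hjm y.1.1 y.1.2).toModuli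
  let ρ : regularFunctions p →+* (slice p j (p - j) k → ℂ) :=
    RingHom.pi fun y => (Pi.evalRingHom (fun _ => ℂ) (π y)).comp (regularFunctions p).subtype
  have hρ : ∀ φ y, ρ φ y = (φ : Moduli p → ℂ) (π y) := fun _ _ => rfl
  let Ψ : (MvPolynomial (Fin (p - j)) ℂ)[X] →+* (slice p j (p - j) k → ℂ) :=
    RingHom.pi fun y => evalAt y.1.1 y.1.2
  have hΨ : ∀ q y, Ψ q y = evalAt y.1.1 y.1.2 q := fun _ _ => rfl
  obtain ⟨q, hq⟩ := exists_evalAt_eq hj hp hjm φ.2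
  have hqφ : Ψ q = ρ φ := funext fun y => (hq _ _).symm
  obtain ⟨r, hr, hr0⟩ := isIntegral_sliceCoordinates (k := k) hj hjp hjm Ψ
    (funext fun y => ((mem_slice_iff hj hjp k y.1).1 y.2).1) (ρ.comp f)
    (fun z => by
      funext y
      rw [RingHom.comp_apply, hρ, hΨ, evalAt_C, MvPolynomial.eval_C]
      simp only [f, AlgHom.toRingHom_eq_coe, RingHom.coe_coe, MvPolynomial.aeval_C]
      rfl)
    (fun t => by
      funext y
      rw [RingHom.comp_apply, hρ, Pi.pow_apply, hΨ, evalAt_C, MvPolynomial.eval_X]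
      simp only [f, AlgHom.toRingHom_eq_coe, RingHom.coe_coe, MvPolynomial.aeval_X, π]
      rw [hξe _ _ (sliceMarked_isNormalized _ _ hj hp hjm), coeff_sliceMarked_add]) q
  refine ⟨r, hr, fun s hs => ?_⟩
  obtain ⟨a, b, rfl⟩ := exists_sliceMarked_of_mem hj hjp hs
  rw [hqφ, ← hom_eval₂] at hr0
  exact congrFun hr0 ⟨(a, b), (sliceMarked_mem_iff a b hj hp hjm k).1 hs⟩

/-- Regular functions pull back to polynomials in `(a, b)`, so primality of the slice equation
transfers to the image. -/
theorem isIrreducible_sliceImage (hj : 2 ≤ j) (hjm : j + (m + 1) ≤ p) :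
    IsIrreducible (sliceImage p j k m) := by
  have hp := (Fact.out : p.Prime).two_le
  have hjp : j < p := by omega
  refine isIrreducible_of_regular ?_ ?_
  · obtain ⟨y, hy, -⟩ := exists_mem_slice (p := p) (m := m + 1) hj hjp hjm k one_ne_zero
    exact ⟨⟨_, (sliceMarked_mem_iff y.1 y.2 hj hp hjm k).2 hy⟩, hj, hp, hjm, y.1, y.2, rfl⟩
  · intro φ hφ ψ hψ h
    obtain ⟨P, hP⟩ := exists_evalAt_eq hj hp hjm hφ
    obtain ⟨Q, hQ⟩ := exists_evalAt_eq hj hp hjm hψ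
    refine (slice_eq_zero_or_eq_zero hj hjp hjm k (P := P) (Q := Q) fun y hy => ?_).imp ?_ ?_
    · rw [← hP, ← hQ]
      exact h ⟨_, (sliceMarked_mem_iff y.1 y.2 hj hp hjm k).2 hy⟩ ⟨hj, hp, hjm, y.1, y.2, rfl⟩
    · rintro h ⟨_, hs⟩ ⟨-, -, -, a, b, rfl⟩
      exact (hP a b).trans (h (a, b) ((sliceMarked_mem_iff a b hj hp hjm k).1 hs))
    · rintro h ⟨_, hs⟩ ⟨-, -, -, a, b, rfl⟩
      exact (hQ a b).trans (h (a, b) ((sliceMarked_mem_iff a b hj hp hjm k).1 hs))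

/-- The regular function `a_{m+1}^{p-1}` vanishes on the smaller family, but not on all of the
larger one. -/
theorem closure_sliceImage_ssubset (hj : 2 ≤ j) (hjm : j + (m + 2) ≤ p) :
    closure (sliceImage p j k m) ⊂ closure (sliceImage p j k (m + 1)) := by
  have hp := (Fact.out : p.Prime).two_le
  refine ⟨closure_mono (sliceImage_mono hjm), fun hle => ?_⟩
  obtain ⟨ξ, hξ, hξe⟩ := exists_regular_coeff_pow (d := p) (j + (m + 1))
  have hcl : IsClosed {s : preperiodicLocus p k 1 j | ξ (s : Moduli p) = 0} :=
    (isClosed_setOf_eq_zero hξ).preimage continuous_subtype_val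
  have hsub : sliceImage p j k m ⊆ {s | ξ (s : Moduli p) = 0} := by
    rintro ⟨_, hs⟩ ⟨-, -, hjm', a, b, rfl⟩
    refine (hξe _ (sliceMarked_isNormalized a b hj hp hjm')).trans ?_
    change (slicePoly p j a b).coeff _ ^ _ = 0
    rw [coeff_slicePoly, if_neg (by omega), if_neg (by omega),
      Finset.sum_eq_zero (fun t _ => if_neg (by omega)), zero_add, zero_add, zero_pow (by omega)]
  obtain ⟨y, hy, hy0⟩ := exists_mem_slice (p := p) (m := m + 2) hj (by omega) hjm k
    (MvPolynomial.X_ne_zero (R := ℂ) (Fin.last (m + 1)))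
  have h0 := closure_minimal hsub hcl (hle (subset_closure
    (show (⟨_, (sliceMarked_mem_iff y.1 y.2 hj hp hjm k).2 hy⟩ : preperiodicLocus p k 1 j) ∈
      sliceImage p j k (m + 1) from ⟨hj, hp, hjm, y.1, y.2, rfl⟩)))
  have h1 := hξe _ (sliceMarked_isNormalized y.1 y.2 hj hp hjm)
  rw [Set.mem_ofPred_eq, h1] at h0
  have h2 := coeff_sliceMarked_add y.1 y.2 hj hp hjm (Fin.last (m + 1))
  rw [Fin.val_last] at h2
  rw [h2] at h0
  rw [MvPolynomial.eval_X] at hy0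
  exact hy0 (eq_zero_of_pow_eq_zero h0)

/-- The regular function `a_0^{p-1}` is constant on the point but not on the one-coefficient family.
-/
theorem exists_closure_singleton_ssubset (hj : 2 ≤ j) (hjm : j + 1 ≤ p) :
    ∃ s : preperiodicLocus p k 1 j, closure {s} ⊂ closure (sliceImage p j k 0) := by
  have hp := (Fact.out : p.Prime).two_le
  obtain ⟨y, hy, -⟩ := exists_mem_slice (p := p) (m := 1) hj (by omega) hjm k one_ne_zero
  have hmem : ∀ y (hy : y ∈ slice p j 1 k),
      (⟨_, (sliceMarked_mem_iff y.1 y.2 hj hp hjm k).2 hy⟩ : preperiodicLocus p k 1 j) ∈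
      sliceImage p j k 0 := fun y _ => ⟨hj, hp, hjm, y.1, y.2, rfl⟩
  refine ⟨⟨_, (sliceMarked_mem_iff y.1 y.2 hj hp hjm k).2 hy⟩,
    closure_mono (Set.singleton_subset_iff.2 (hmem y hy)), fun hle => ?_⟩
  obtain ⟨ξ, hξ, hξe⟩ := exists_regular_coeff_pow (d := p) j
  have hval : ∀ y : (Fin 1 → ℂ) × ℂ,
      ξ (sliceMarked hj hp hjm y.1 y.2).toModuli = y.1 0 ^ (p - 1) := fun y => by
    rw [hξe _ (sliceMarked_isNormalized y.1 y.2 hj hp hjm)]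
    have h2 := coeff_sliceMarked_add y.1 y.2 hj hp hjm 0
    rw [Fin.val_zero, add_zero] at h2
    rw [h2]
  have hcl : IsClosed {s : preperiodicLocus p k 1 j |
      (ξ - algebraMap ℂ (Moduli p → ℂ) (y.1 0 ^ (p - 1))) (s : Moduli p) = 0} :=
    (isClosed_setOf_eq_zero ((regularFunctions p).sub_mem hξ
      ((regularFunctions p).algebraMap_mem _))).preimage continuous_subtype_val
  have hc : (MvPolynomial.X 0 ^ (p - 1) - MvPolynomial.C (y.1 0 ^ (p - 1)) :
      MvPolynomial (Fin 1) ℂ) ≠ 0 := by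
    intro h
    have h1 := congrArg (MvPolynomial.eval fun _ => (0 : ℂ)) h
    have h2 := congrArg (MvPolynomial.eval fun _ => (1 : ℂ)) h
    have h0 : p - 1 ≠ 0 := by omega
    simp only [map_sub, map_pow, MvPolynomial.eval_X, MvPolynomial.eval_C, map_zero, one_pow,
      zero_pow h0, zero_sub, neg_eq_zero] at h1 h2
    rw [h1, sub_zero] at h2
    exact one_ne_zero h2
  obtain ⟨z, hz, hz0⟩ := exists_mem_slice (p := p) (m := 1) hj (by omega) hjm k hc
  have h0 := closure_minimal (Set.singleton_subset_iff.2 ?_) hcl (hle (subset_closure (hmem z hz)))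
  · have h1 : ξ (sliceMarked hj hp hjm z.1 z.2).toModuli - y.1 0 ^ (p - 1) = 0 := h0
    rw [hval] at h1
    exact hz0 (by simpa using h1)
  · change ξ (sliceMarked hj hp hjm y.1 y.2).toModuli - y.1 0 ^ (p - 1) = 0
    rw [hval, sub_self]

theorem le_topologicalKrullDim_preperiodicLocus (hj : 2 ≤ j) (hjp : j < p) :
    ((p - j : ℕ) : WithBot ℕ∞) ≤ topologicalKrullDim (preperiodicLocus p k 1 j) := by
  obtain ⟨s, hs⟩ := exists_closure_singleton_ssubset (k := k) hj (show j + 1 ≤ p from hjp)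
  -- Index `0` is the point and index `i + 1` the family with `i + 1` coefficients: `p - j + 1`
  -- sets, hence length `p - j`.
  let T : ℕ → Set (preperiodicLocus p k 1 j) := fun i => Nat.casesOn i {s} (sliceImage p j k)
  have hT : ∀ i : Fin (p - j + 1), IsIrreducible (T i) := by
    rintro ⟨_ | i, hi⟩
    · exact isIrreducible_singleton
    · exact isIrreducible_sliceImage hj (by omega)
  let c : LTSeries (TopologicalSpace.IrreducibleCloseds (preperiodicLocus p k 1 j)) :=
    LTSeries.mk (p - j) (fun i => ⟨closure (T i), (hT i).closure, isClosed_closure⟩) (by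
      refine Fin.strictMono_iff_lt_succ.2 ?_
      rintro ⟨_ | i, hi⟩
      · exact hs
      · exact closure_sliceImage_ssubset hj (by omega))
  exact Order.LTSeries.length_le_krullDim c

theorem isIrreducible_preperiodicLocus (hj : 2 ≤ j) (hjp : j < p) :
    IsIrreducible (preperiodicLocus p k 1 j) := by
  obtain ⟨m, hm⟩ : ∃ m, p - j = m + 1 := ⟨p - j - 1, by omega⟩
  have hirr := isIrreducible_sliceImage (k := k) (m := m) hj (show j + (m + 1) ≤ p by omega)
  have h := hirr.image Subtype.val continuous_subtype_val.continuousOn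
  -- With all `p - j` coefficients allowed, the slice image is the whole locus.
  convert! h
  refine Set.Subset.antisymm (fun x hx => ?_) (Subtype.coe_image_subset _ _)
  obtain ⟨a, b, rfl⟩ := exists_sliceMarked_of_mem hj hjp hx
  refine ⟨⟨_, hx⟩, ⟨hj, by omega, by omega, fun i => a (i.cast hm.symm), b, ?_⟩, rfl⟩
  refine congrArg _ (MarkedPoly.ext' ?_ rfl)
  change slicePoly p j _ b = slicePoly p j a b
  rw [slicePoly, slicePoly]
  congr 2
  exact Fintype.sum_equiv (finCongr hm.symm) _ _ fun i => rfl

end Slice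

end MarkedModuli

theorem corollary6p2 (p : ℕ) [Fact p.Prime] (hp : Odd p) (k j : ℕ) (hj : 2 ≤ j)
    (hjp : j ≤ p - 1) :
    IsLocallyClosed (MarkedModuli.preperiodicLocus p k 1 j) ∧
      IsIrreducible (MarkedModuli.preperiodicLocus p k 1 j) ∧
      topologicalKrullDim (MarkedModuli.preperiodicLocus p k 1 j) = ((p - j : ℕ) : WithBot ℕ∞) :=
  have hlt : j < p := by omega
  ⟨MarkedModuli.isLocallyClosed_preperiodicLocus (by omega),
    MarkedModuli.isIrreducible_preperiodicLocus hj hlt,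
    (MarkedModuli.topologicalKrullDim_preperiodicLocus_le hj hlt).antisymm
      (MarkedModuli.le_topologicalKrullDim_preperiodicLocus hj hlt)⟩
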